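/- Let $A=(a_{ij})$ be a $d\times d$ matrix of non-negative integers with $\det A\neq 0$, and let $W(x_1,\dots,x_d)=\sum_{i=1}^d\prod_{j=1}^d x_j^{a_{ij}}$. Assume that the solution $(q_j)$ of $\sum_j a_{ij}q_j=1$ $(1\le i\le d)$ consists of positive rational numbers, and that the hypersurface $W=0$ in $\mathbb C^d$ is smooth away from the origin. Let $\mathrm{Aut}(W)=\{\gamma\in(\mathbb C^*)^d:\ \prod_j\gamma_j^{a_{ij}}=1\text{ for all }i\}$ (a finite group), let $SL_W=\{\gamma\in\mathrm{Aut}(W):\ \prod_j\gamma_j=1\}$ and $J_W=(e^{2\pi i q_j})_j$, and let $G$ be a group with $\langle J_W\rangle\subset G\subset SL_W$. For $\gamma\in G$ let $\theta_j(\gamma)\in[0,1)$ be defined by $\gamma_j=e^{2\pi i\theta_j(\gamma)}$. Put $\hat c=d-2\sum_j q_j$ and, for $\nu,\tau\in\mathbb C$ with $\operatorname{Im}\tau>0$ and $q=e^{2\pi i\tau}$, $$\Theta(\nu,\tau)=i\,q^{1/8}e^{-i\pi\nu}(1-e^{2\pi i\nu})\prod_{n\ge1}(1-q^n)(1-q^ne^{2\pi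 i\nu})(1-q^ne^{-2\pi i\nu}).$$ Let $$Ell(W/G,z,\tau)=\frac1{|G|}\sum_{n,n_1\in G}\ \prod_{j=1}^d e^{-2\pi i z\theta_j(n)}\,\frac{\Theta\big((1-q_j)z-\theta_j(n)\tau-\theta_j(n_1),\tau\big)}{\Theta\big(q_jz+\theta_j(n)\tau+\theta_j(n_1),\tau\big)},$$ which is defined on the set of $(z,\tau)$, $\operatorname{Im}\tau>0$, where no denominator vanishes; this set is dense in $\{(z,\tau):\ z\in\mathbb C,\ \operatorname{Im}\tau>0\}$, and at the remaining points $Ell(W/G,z,\tau)$ is defined as the limit of the above values. Then $\hat c$ is an integer and $Ell(W/G,z,\tau)$ is a weak Jacobi form of weight $0$ and index $\hat c/2$, with a character allowed when $\hat c$ is odd. That is: $Ell(W/G,z,\tau)$ is holomorphic on $\mathbb C\times\{\operatorname{Im}\tau>0\}$ (in particular the limits exist); for all $z\in\mathbb C$ and $\operatorname{Im}\tau>0$ $$Ell(W/G,z,\tau+1)=Ell(W/G,z,\tau),\qquad Ell(W/G,z+1,\tau)=(-1)^{\hat c}Ell(W/G,z,\tau),$$ $$Ell(W/G,z+\tau,\tau)=(-1)^{\hat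 c}e^{-i\pi\hat c(\tau+2z)}Ell(W/G,z,\tau),\qquad Ell\Big(W/G,\frac z\tau,-\frac1\tau\Big)=e^{i\pi\hat c z^2/\tau}Ell(W/G,z,\tau),$$ and hence, for all $\begin{pmatrix}a&b\\c&e\end{pmatrix}\in SL_2(\mathbb Z)$ and $\lambda,\mu\in\mathbb Z$, $$Ell\Big(W/G,\frac{z}{c\tau+e},\frac{a\tau+b}{c\tau+e}\Big)=e^{i\pi\hat c\,cz^2/(c\tau+e)}Ell(W/G,z,\tau),$$ $$Ell(W/G,z+\lambda\tau+\mu,\tau)=(-1)^{\hat c(\lambda+\mu)}e^{-i\pi\hat c(\lambda^2\tau+2\lambda z)}Ell(W/G,z,\tau);$$ and only non-negative powers of $q$ appear at the cusp: there are complex numbers $c(n,l)$ $(n\ge0,\ l\in\mathbb Z)$ with $$Ell(W/G,z,\tau)=\sum_{n\ge0,\ l\in\mathbb Z}c(n,l)\,q^n\,e^{2\pi i z(l+\hat c/2)}$$ for all $z\in\mathbb C$ and $\operatorname{Im}\tau>0$, the series being absolutely convergent. -/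

import Mathlib

open scoped BigOperators Topology

noncomputable section

namespace BerglundHubsch

/-- The polynomial `∑ i, ∏ j, x_j ^ a_ij` with exponent matrix `A = (a_ij)`. -/
def polynomial {d : ℕ} (A : Matrix (Fin d) (Fin d) ℕ) : MvPolynomial (Fin d) ℂ :=
  ∑ i, ∏ j, MvPolynomial.X j ^ A i j

/-- A non-degenerate invertible polynomial potential
`W(x_1, …, x_d) = ∑ i, ∏ j, x_j ^ a_ij` in `d` variables: the exponent matrix is invertible,
`W` is homogeneous of degree `1` for positive rational degrees `q_j` of the variables (which are
determined by the exponents), and the hypersurface `W = 0` in `ℂ^d` is smooth away from the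
origin. -/
structure Potential (d : ℕ) where
  /-- the exponent matrix `(a_ij)` -/
  A : Matrix (Fin d) (Fin d) ℕ
  det_ne_zero : (A.map (fun a : ℕ => (a : ℚ))).det ≠ 0
  /-- the degrees `q_j` of the variables -/
  q : Fin d → ℚ
  q_pos : ∀ j, 0 < q j
  homogeneous : ∀ i, ∑ j, (A i j : ℚ) * q j = 1
  nondegenerate : ∀ x : Fin d → ℂ,
    MvPolynomial.eval x (polynomial A) = 0 →
    (∀ k, MvPolynomial.eval x (MvPolynomial.pderiv k (polynomial A)) = 0) →
    x = 0

namespace Potential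

variable {d : ℕ} (W : Potential d)

/-- The group `Aut(W)` of diagonal automorphisms `x_j ↦ γ_j x_j`
with `∏ j, γ_j ^ a_ij = 1` for all `i`. -/
def Aut : Subgroup (Fin d → ℂˣ) where
  carrier := {γ | ∀ i, ∏ j, γ j ^ W.A i j = 1}
  one_mem' := by simp
  mul_mem' := by
    intro γ δ hγ hδ i
    simp only [Pi.mul_apply, mul_pow, Finset.prod_mul_distrib]
    rw [hγ i, hδ i, one_mul]
  inv_mem' := by
    intro γ hγ i
    simp only [Pi.inv_apply, inv_pow, Finset.prod_inv_distrib]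
    rw [hγ i, inv_one]

/-- The subgroup `SL_W` of the diagonal automorphisms with `∏ j, γ_j = 1`. -/
def SL : Subgroup (Fin d → ℂˣ) where
  carrier := {γ | γ ∈ W.Aut ∧ ∏ j, γ j = 1}
  one_mem' := ⟨W.Aut.one_mem, by simp⟩
  mul_mem' := by
    rintro γ δ ⟨hγ, hγ'⟩ ⟨hδ, hδ'⟩
    refine ⟨W.Aut.mul_mem hγ hδ, ?_⟩
    simp only [Pi.mul_apply, Finset.prod_mul_distrib]
    rw [hγ', hδ', one_mul]
  inv_mem' := by
    rintro γ ⟨hγ, hγ'⟩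
    refine ⟨W.Aut.inv_mem hγ, ?_⟩
    simp only [Pi.inv_apply, Finset.prod_inv_distrib]
    rw [hγ', inv_one]

/-- The exponential grading operator `J_W : x_j ↦ exp(2 π i q_j) x_j`. -/
def J : Fin d → ℂˣ := fun j =>
  Units.mk0 (Complex.exp (2 * Real.pi * Complex.I * (W.q j : ℂ))) (Complex.exp_ne_zero _)

/-- The central charge `ĉ = d - 2 ∑ j, q_j`. -/
def cHat : ℚ := d - 2 * ∑ j, W.q j

/-- The group `Aut(W)` is finite. -/
theorem finite_Aut : (W.Aut : Set (Fin d → ℂˣ)).Finite := by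
  set B : Matrix (Fin d) (Fin d) ℤ := W.A.map (fun a : ℕ => (a : ℤ)) with hB
  have hdet : B.det ≠ 0 := by
    intro h
    apply W.det_ne_zero
    have h1 : W.A.map (fun a : ℕ => (a : ℚ)) = (Int.castRingHom ℚ).mapMatrix B := by
      ext i j
      simp [hB]
    rw [h1, ← RingHom.map_det, h, map_zero]
  have hN : B.det.natAbs ≠ 0 := Int.natAbs_ne_zero.mpr hdet
  have hNZ : NeZero B.det.natAbs := ⟨hN⟩
  have hfin : ((rootsOfUnity B.det.natAbs ℂ : Subgroup ℂˣ) : Set ℂˣ).Finite :=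
    Set.finite_coe_iff.mp (inferInstanceAs (Finite (rootsOfUnity B.det.natAbs ℂ)))
  refine (Set.Finite.pi' (fun _ : Fin d => hfin)).subset ?_
  intro γ hγ k
  have hγ' : ∀ i, ∏ j, γ j ^ B i j = 1 := by
    intro i
    have := hγ i
    simpa [hB, zpow_natCast] using this
  have h2 : ∏ i, (∏ j, γ j ^ B i j) ^ (B.adjugate k i) = γ k ^ B.det := by
    have h3 : ∀ j, ∑ i, B i j * B.adjugate k i = if k = j then B.det else 0 := by
      intro j
      have h4 := congrFun (congrFun B.adjugate_mul k) j
      rw [Matrix.mul_apply] at h4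
      simp only [Matrix.smul_apply, Matrix.one_apply, smul_eq_mul, mul_ite, mul_one,
        mul_zero] at h4
      rw [← h4]
      exact Finset.sum_congr rfl (fun i _ => mul_comm _ _)
    simp_rw [← Finset.prod_zpow, ← zpow_mul]
    rw [Finset.prod_comm]
    have h5 : ∀ j, ∏ i, γ j ^ (B i j * B.adjugate k i) = γ j ^ (if k = j then B.det else 0) := by
      intro j
      rw [← h3 j]
      exact (map_sum (zpowersHom ℂˣ (γ j)).toAdditive _ _).symm
    rw [Finset.prod_congr rfl (fun j _ => h5 j), Finset.prod_eq_single k]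
    · simp
    · intro j _ hj
      simp [Ne.symm hj]
    · simp
  have h6 : γ k ^ B.det = 1 := by
    rw [← h2]
    simp [hγ']
  rw [SetLike.mem_coe, mem_rootsOfUnity]
  rcases Int.natAbs_eq B.det with h | h
  · rw [h, zpow_natCast] at h6
    exact h6
  · rw [h, zpow_neg, zpow_natCast, inv_eq_one] at h6
    exact h6

end Potential

/-- Jacobi's theta function
`Θ(ν, τ) = i q^(1/8) e^(-iπν) (1 - e^(2πiν)) ∏_{n ≥ 1} (1 - q^n)(1 - q^n e^(2πiν))(1 - q^n e^(-2πiν))`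
with `q = e^(2πiτ)`, for `Im τ > 0`. -/
def Theta (ν τ : ℂ) : ℂ :=
  Complex.I * Complex.exp (2 * Real.pi * Complex.I * τ / 8) *
    Complex.exp (-(Complex.I * Real.pi * ν)) * (1 - Complex.exp (2 * Real.pi * Complex.I * ν)) *
    ∏' n : ℕ, ((1 - Complex.exp (2 * Real.pi * Complex.I * τ) ^ (n + 1)) *
      (1 - Complex.exp (2 * Real.pi * Complex.I * τ) ^ (n + 1) *
        Complex.exp (2 * Real.pi * Complex.I * ν)) *
      (1 - Complex.exp (2 * Real.pi * Complex.I * τ) ^ (n + 1) *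
        Complex.exp (-(2 * Real.pi * Complex.I * ν))))

/-- For `γ = (γ_j)` with `|γ_j| = 1`, the number `θ_j(γ) ∈ [0, 1)` with
`γ_j = exp(2 π i θ_j(γ))`. -/
def theta {d : ℕ} (j : Fin d) (γ : Fin d → ℂˣ) : ℝ :=
  Int.fract (Complex.arg (γ j : ℂ) / (2 * Real.pi))

theorem theta_mem_Ico {d : ℕ} (j : Fin d) (γ : Fin d → ℂˣ) : theta j γ ∈ Set.Ico (0 : ℝ) 1 :=
  ⟨Int.fract_nonneg _, Int.fract_lt_one _⟩

theorem exp_theta {d : ℕ} (j : Fin d) (γ : Fin d → ℂˣ) (h : ‖(γ j : ℂ)‖ = 1) :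
    Complex.exp (2 * Real.pi * Complex.I * (theta j γ : ℂ)) = (γ j : ℂ) := by
  have hpi : (Real.pi : ℂ) ≠ 0 := Complex.ofReal_ne_zero.mpr Real.pi_ne_zero
  have h1 : 2 * Real.pi * Complex.I * (theta j γ : ℂ) =
      (Complex.arg (γ j : ℂ) : ℂ) * Complex.I -
        (⌊Complex.arg (γ j : ℂ) / (2 * Real.pi)⌋ : ℤ) * (2 * Real.pi * Complex.I) := by
    unfold theta Int.fract
    push_cast
    field_simp
  rw [h1, Complex.exp_sub, Complex.exp_int_mul_two_pi_mul_I, div_one]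
  have h2 := Complex.norm_mul_exp_arg_mul_I (γ j : ℂ)
  rwa [h, Complex.ofReal_one, one_mul] at h2

variable {d : ℕ}

/-- The quotient of theta functions
`1/|G| ∑_{n, n₁ ∈ G} ∏ j, e^(-2πi z θ_j(n)) Θ((1-q_j)z - θ_j(n)τ - θ_j(n₁), τ) /
  Θ(q_j z + θ_j(n)τ + θ_j(n₁), τ)`,
a meromorphic expression in `(z, τ)`, `Im τ > 0`; it is meaningful where no denominator
vanishes. -/
def ellQuotient (W : Potential d) (G : Subgroup (Fin d → ℂˣ)) (p : ℂ × ℂ) : ℂ :=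
  (1 / (Nat.card G : ℂ)) * ∑ᶠ (n : G) (n₁ : G), ∏ j : Fin d,
    (Complex.exp (-(2 * Real.pi * Complex.I * p.1 * (theta j n : ℂ))) *
      (Theta ((1 - (W.q j : ℂ)) * p.1 - (theta j n : ℂ) * p.2 - (theta j n₁ : ℂ)) p.2 /
        Theta ((W.q j : ℂ) * p.1 + (theta j n : ℂ) * p.2 + (theta j n₁ : ℂ)) p.2))

/-- The set of all `(z, τ)`, `Im τ > 0`, where none of the denominators of `ellQuotient`
vanishes. -/
def regularLocus (W : Potential d) (G : Subgroup (Fin d → ℂˣ)) : Set (ℂ × ℂ) :=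
  {p | 0 < p.2.im ∧ ∀ n ∈ G, ∀ n₁ ∈ G, ∀ j : Fin d,
    Theta ((W.q j : ℂ) * p.1 + (theta j n : ℂ) * p.2 + (theta j n₁ : ℂ)) p.2 ≠ 0}

/-- The elliptic genus `Ell(W/G, z, τ)`: the function on `ℂ × {Im τ > 0}` that the quotient of
theta functions defines, its value at a zero of a denominator being the limit from the points
where no denominator vanishes. -/
def Ell (W : Potential d) (G : Subgroup (Fin d → ℂˣ)) (z τ : ℂ) : ℂ :=
  extendFrom (regularLocus W G) (ellQuotient W G) (z, τ)

/-- `φ(z, τ)` is a weak Jacobi form of weight `k` and index `t / 2`, where `t` is an integer; the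
lattice translation by `lam * τ + mu` acts with the character `(-1) ^ (t (lam + mu))`, which is
trivial for even `t`. Weak: only non-negative powers of `q = e^(2πiτ)` appear in the Fourier
expansion. -/
structure IsWeakJacobiForm (k t : ℤ) (φ : ℂ → ℂ → ℂ) : Prop where
  holomorphic : DifferentiableOn ℂ (fun p : ℂ × ℂ => φ p.1 p.2) {p | 0 < p.2.im}
  modular : ∀ (g : Matrix.SpecialLinearGroup (Fin 2) ℤ) (z τ : ℂ), 0 < τ.im →
    φ (z / ((g 1 0 : ℂ) * τ + (g 1 1 : ℂ)))
        (((g 0 0 : ℂ) * τ + (g 0 1 : ℂ)) / ((g 1 0 : ℂ) * τ + (g 1 1 : ℂ))) =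
      ((g 1 0 : ℂ) * τ + (g 1 1 : ℂ)) ^ k *
        Complex.exp (2 * Real.pi * Complex.I * ((t : ℂ) / 2) *
          ((g 1 0 : ℂ) * z ^ 2 / ((g 1 0 : ℂ) * τ + (g 1 1 : ℂ)))) * φ z τ
  elliptic : ∀ (lam mu : ℤ) (z τ : ℂ), 0 < τ.im →
    φ (z + lam * τ + mu) τ =
      (-1 : ℂ) ^ (t * (lam + mu)) *
        Complex.exp (-(2 * Real.pi * Complex.I * ((t : ℂ) / 2) *
          ((lam : ℂ) ^ 2 * τ + 2 * lam * z))) * φ z τ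
  cusp : ∃ c : ℕ → ℤ → ℂ, ∀ z τ : ℂ, 0 < τ.im →
    HasSum (fun p : ℕ × ℤ => c p.1 p.2 *
      Complex.exp (2 * Real.pi * Complex.I * τ * (p.1 : ℂ)) *
      Complex.exp (2 * Real.pi * Complex.I * z * ((p.2 : ℂ) + (t : ℂ) / 2))) (φ z τ)

end BerglundHubsch

end

/-!
The elliptic genus is a sum over `γ, δ ∈ G` of products over `j` of the factors `thetaQuot q_j
θ_j(γ) θ_j(δ) z τ`, a power of `exp z` times a quotient of two values of `Θ`. Three independent
facts make it a weak Jacobi form.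

*Transformation laws.* The quasi-periodicity of `Θ(·, τ)` under `1` and `τ` shows that a factor
depends on `θ_j(γ)` and `θ_j(δ)` modulo `1` only (`thetaQuot_add_int`), so that a summand depends
just on `γ` and `δ` (`ellTerm_eq`). The substitutions `z ↦ z + 1`, `z ↦ z + τ`, `τ ↦ τ + 1` and
`(z, τ) ↦ (z / τ, -1 / τ)` turn the summand of `(γ, δ)` into an elementary factor times the
summand of `(γ, δ J)`, `(γ J, δ)`, `(γ, δ γ)` and `(δ, γ⁻¹)`; the elementary factors do not depend
on the summand because all elements of `G` have determinant one. The inversion formula for `Θ` is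
needed only up to a constant depending on `τ`, which cancels in the quotients. It holds because
the entire functions with the quasi-periodicity of `Θ(·, τ)` form a space of dimension one: their
Fourier coefficients satisfy a recursion (`eq_zero_of_lineCoeff_eq_zero`,
`exists_Theta_inversion`). The laws for `SL(2, ℤ)` and for the whole lattice follow from those for
generators.

*Holomorphy.* Write a point as `(a τ₀ + b, τ₀)` with real `a`, `b`. All zeros of `Θ(·, τ)` are
simple and lie at the lattice points, so near this point the zeros and poles of all factors lie on
the curve `z = a τ + b`, and it has to be shown that at least as many numerators as denominators
vanish there (`exists_local_extension`). The numbers `q_j a + θ_j(γ)` and `q_j b + θ_j(δ)` are the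
logarithms of two torus elements which multiply every monomial of `W` by `exp (2 π i a)` and `exp
(2 π i b)`. The denominators that vanish correspond to the coordinates fixed by both elements, the
numerators that vanish to the coordinates that transform like the monomials. If the multipliers
are not both `1`, then on the fixed subspace `W` vanishes, and so do all its partial derivatives
except those with respect to the coordinates of the second kind; since `W` is non-degenerate,
these have no common zero on the subspace but the origin, and by Krull's height theorem they are
at least as many as its dimension (`Potential.card_eq_zero_le_card_eq`). If `W` has a linear
monomial the derivatives need not vanish at the origin, but then all summands are zero
(`ellTerm_eq_zero_of_linear`).

*The cusp.* A holomorphic function that is `1`-periodic in both variables is the sum of its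
absolutely convergent double Fourier series (`hasSum_torusCoeff`), whose coefficients can be
computed on any torus `Im z = y`, `Im τ = t`. For `Im z = 1` no denominator vanishes once `Im τ`
is large, and since `0 ≤ θ_j < 1` the factors stay bounded as `Im τ → ∞`
(`eventually_norm_thetaQuot_le`). Hence the coefficients of negative powers of `exp (2 π i τ)`
vanish.
-/

noncomputable section

/-! ### Systems of polynomial equations with an isolated solution -/

namespace MvPolynomial

/-- The algebra endomorphism that puts the variables in `s` equal to zero. Its kernel is the prime
ideal generated by these variables. -/
def zeroVars {σ K : Type*} [Field K] [DecidableEq σ] (s : Finset σ) :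
    MvPolynomial σ K →ₐ[K] MvPolynomial σ K :=
  aeval fun i => if i ∈ s then 0 else X i

theorem zeroVars_zeroVars {σ K : Type*} [Field K] [DecidableEq σ] {s t : Finset σ} (h : s ⊆ t)
    (p : MvPolynomial σ K) : zeroVars t (zeroVars s p) = zeroVars t p := by
  have : (zeroVars t).comp (zeroVars (K := K) s) = zeroVars t := by
    ext i : 1
    by_cases hi : i ∈ s <;> simp [zeroVars, hi]
    simp [h hi]
  exact DFunLike.congr_fun this p

theorem card_le_height_ker_zeroVars {σ K : Type*} [Field K] [DecidableEq σ] (s : Finset σ) :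
    (s.card : ℕ∞) ≤ (RingHom.ker (zeroVars (K := K) s)).height := by
  induction s using Finset.induction_on with
  | empty => simp
  | insert a s ha ih =>
    rw [Finset.card_insert_of_notMem ha]
    have hp : (RingHom.ker (zeroVars (K := K) s)).IsPrime := RingHom.ker_isPrime _
    have hp' : (RingHom.ker (zeroVars (K := K) (insert a s))).IsPrime := RingHom.ker_isPrime _
    have hlt : RingHom.ker (zeroVars (K := K) s) <
        RingHom.ker (zeroVars (K := K) (insert a s)) := by
      refine lt_of_le_of_ne (fun p hp => ?_) fun h => ?_
      · rw [RingHom.mem_ker] at hp ⊢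
        rw [← zeroVars_zeroVars (Finset.subset_insert a s), hp, map_zero]
      · have : (X a : MvPolynomial σ K) ∈ RingHom.ker (zeroVars (K := K) s) := by
          rw [h, RingHom.mem_ker]
          simp [zeroVars]
        rw [RingHom.mem_ker] at this
        simp [zeroVars, ha] at this
    calc ((s.card + 1 : ℕ) : ℕ∞) = s.card + 1 := by simp
      _ ≤ (RingHom.ker (zeroVars (K := K) s)).height + 1 := by gcongr
      _ ≤ _ := Ideal.height_add_one_le_of_lt_of_isPrime hlt

theorem zeroVars_univ {σ K : Type*} [Field K] [DecidableEq σ] [Fintype σ] (p : MvPolynomial σ K) :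
    zeroVars Finset.univ p = C (eval 0 p) := by
  have : zeroVars (K := K) (σ := σ) Finset.univ = (Algebra.ofId K _).comp (aeval 0) := by
    ext i : 1
    simp [zeroVars]
  rw [this]
  simp only [AlgHom.comp_apply, aeval_eq_eval, Algebra.ofId_apply, algebraMap_eq]

/-- Polynomials without constant term in `n` variables whose only common zero is the origin are at
least `n` in number: by the Nullstellensatz the ideal of the origin, of height `n`, is minimal
over them, so that Krull's height theorem applies. -/
theorem card_le_card_of_common_zero {σ ι K : Type*} [Field K] [IsAlgClosed K] [Fintype σ]
    (T : Finset ι) (f : ι → MvPolynomial σ K) (h0 : ∀ k ∈ T, eval 0 (f k) = 0)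
    (h : ∀ x, (∀ k ∈ T, eval x (f k) = 0) → x = 0) : Fintype.card σ ≤ T.card := by
  classical
  have hp : (RingHom.ker (zeroVars (K := K) (σ := σ) Finset.univ)).IsPrime := RingHom.ker_isPrime _
  have hmin : RingHom.ker (zeroVars (K := K) (σ := σ) Finset.univ) ∈
      (Ideal.span ((T.image f : Finset _) : Set (MvPolynomial σ K))).minimalPrimes := by
    refine ⟨⟨hp, ?_⟩, ?_⟩
    · rw [Ideal.span_le]
      intro p hp
      simp only [Finset.coe_image, Set.mem_image, Finset.mem_coe] at hp
      obtain ⟨k, hk, rfl⟩ := hp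
      rw [SetLike.mem_coe, RingHom.mem_ker, zeroVars_univ, h0 k hk, map_zero]
    · rintro P ⟨hP, hle⟩ - p hp
      rw [RingHom.mem_ker, zeroVars_univ, C_eq_zero] at hp
      rw [← IsPrime.vanishingIdeal_zeroLocus (K := K) P, mem_vanishingIdeal_iff]
      intro x hx
      have : x = 0 := by
        refine h x fun k hk => ?_
        rw [mem_zeroLocus_iff] at hx
        have := hx (f k) (hle (Ideal.subset_span (by simpa using ⟨k, hk, rfl⟩)))
        simpa [aeval_eq_eval] using this
      subst this
      simpa [aeval_eq_eval] using hp
  have h1 := Ideal.height_le_card_of_mem_minimalPrimes_span_finset hmin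
  have h2 := (card_le_height_ker_zeroVars (K := K) (Finset.univ : Finset σ)).trans h1
  rw [Nat.cast_le] at h2
  exact h2.trans Finset.card_image_le

end MvPolynomial

namespace BerglundHubsch

/-! ### Zeros and poles of a summand -/

theorem eval_polynomial {d : ℕ} (A : Matrix (Fin d) (Fin d) ℕ) (x : Fin d → ℂ) :
    MvPolynomial.eval x (polynomial A) = ∑ i, ∏ j, x j ^ A i j := by
  simp [polynomial]

theorem eval_pderiv_polynomial {d : ℕ} (A : Matrix (Fin d) (Fin d) ℕ) (k : Fin d) (x : Fin d → ℂ) :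
    MvPolynomial.eval x (MvPolynomial.pderiv k (polynomial A)) =
      ∑ i, (A i k : ℂ) * ∏ j, x j ^ (A i j - if j = k then 1 else 0) := by
  have h (i : Fin d) : ∏ j, (MvPolynomial.X j : MvPolynomial (Fin d) ℂ) ^ A i j =
      MvPolynomial.monomial (Finsupp.equivFunOnFinite.symm (A i)) 1 := by
    rw [MvPolynomial.monomial_eq, Finsupp.prod_fintype _ _ (by simp)]
    simp
  simp only [polynomial, h, map_sum, MvPolynomial.pderiv_monomial, MvPolynomial.eval_monomial]
  refine Finset.sum_congr rfl fun i _ => ?_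
  rw [Finsupp.prod_fintype _ _ (by simp)]
  simp [Finsupp.single_apply, eq_comm]

/-- If the torus element `g` multiplies every monomial of `W` by the same `e` (in additive
notation), then at most as many coordinates are fixed by `g` as are multiplied by `e`. For `e ≠ 0`
the potential vanishes on the subspace fixed by `g`, where only the partial derivatives with
respect to the coordinates of the second kind can be non-zero; as `W` is non-degenerate, their only
common zero there is the origin. -/
theorem Potential.card_eq_zero_le_card_eq {d : ℕ} (W : Potential d)
    (hlin : ∀ i k, W.A i ≠ Pi.single k 1) {M : Type*} [AddCommGroup M] [DecidableEq M]
    (g : Fin d → M) (e : M) (he : ∀ i, ∑ j, W.A i j • g j = e) :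
    (Finset.univ.filter fun j => g j = 0).card ≤ (Finset.univ.filter fun j => g j = e).card := by
  classical
  rcases eq_or_ne e 0 with rfl | he0
  · rfl
  set S := Finset.univ.filter fun j => g j = 0 with hS
  have memS (j) : j ∈ S ↔ g j = 0 := by simp [hS]
  let r : MvPolynomial (Fin d) ℂ →ₐ[ℂ] MvPolynomial S ℂ :=
    MvPolynomial.aeval fun j => if h : j ∈ S then MvPolynomial.X ⟨j, h⟩ else 0
  let ext (x : S → ℂ) : Fin d → ℂ := fun j => if h : j ∈ S then x ⟨j, h⟩ else 0
  have hr (x : S → ℂ) (p) : MvPolynomial.eval x (r p) = MvPolynomial.eval (ext x) p := by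
    have : (MvPolynomial.aeval x).comp r = MvPolynomial.aeval (R := ℂ) (ext x) := by
      ext j
      by_cases h : j ∈ S <;> simp [r, ext, h]
    simpa [MvPolynomial.aeval_eq_eval] using DFunLike.congr_fun this p
  have hmono (i) : ∃ j, j ∉ S ∧ W.A i j ≠ 0 := by
    by_contra! h
    refine he0 ((he i).symm.trans (Finset.sum_eq_zero fun j _ => ?_))
    by_cases hj : j ∈ S
    · rw [(memS j).1 hj, smul_zero]
    · rw [h j hj, zero_smul]
  rw [← Fintype.card_coe S]
  -- The polynomials are the restrictions of `∂W/∂x_k`, `g k = e`, to the subspace fixed by `g`.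
  -- They vanish at the origin because no monomial of `W` is linear.
  refine MvPolynomial.card_le_card_of_common_zero _
    (fun k => r (MvPolynomial.pderiv k (polynomial W.A))) (fun k _ => ?_) fun x hx => ?_
  · rw [hr, eval_pderiv_polynomial]
    have : ext 0 = 0 := by
      ext j
      simp [ext]
    rw [this]
    refine Finset.sum_eq_zero fun i _ => ?_
    by_cases hik : W.A i k = 0
    · simp [hik]
    have : ∃ j, W.A i j - (if j = k then 1 else 0) ≠ 0 := by
      by_contra! h
      refine hlin i k (funext fun j => ?_)
      have := h j
      rcases eq_or_ne j k with rfl | hj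
      · simp at this ⊢
        omega
      · simpa [hj] using this
    obtain ⟨j, hj⟩ := this
    rw [Finset.prod_eq_zero (Finset.mem_univ j) (by simp [hj]), mul_zero]
  · have hx0 : ext x = 0 := by
      refine W.nondegenerate _ ?_ fun k => ?_
      · rw [eval_polynomial]
        refine Finset.sum_eq_zero fun i _ => ?_
        obtain ⟨j, hj, hij⟩ := hmono i
        exact Finset.prod_eq_zero (Finset.mem_univ j) (by simp [ext, hj, hij])
      · by_cases hk : g k = e
        · rw [← hr]
          exact hx k (by simpa using hk)
        rw [eval_pderiv_polynomial]
        refine Finset.sum_eq_zero fun i _ => ?_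
        by_contra hne
        have hik : W.A i k ≠ 0 := fun h => hne (by simp [h])
        -- If the `i`-th monomial contributes to `∂W/∂x_k` on the fixed subspace, then `x_k` is
        -- the only variable outside `S` that occurs in it, with exponent one, so that `g k = e`.
        have hfac (j) (hj : j ∉ S) : W.A i j - (if j = k then 1 else 0) = 0 := by
          by_contra h
          refine hne ?_
          rw [Finset.prod_eq_zero (Finset.mem_univ j) (by simp [ext, hj, h]), mul_zero]
        have hother (j) (hj : j ≠ k) : W.A i j • g j = 0 := by
          by_cases hjS : j ∈ S
          · rw [(memS j).1 hjS, smul_zero]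
          · have := hfac j hjS
            rw [if_neg hj, Nat.sub_zero] at this
            rw [this, zero_smul]
        have hsum : W.A i k • g k = e := by
          rw [← he i, Finset.sum_eq_single k (fun j _ hj => hother j hj) (by simp)]
        by_cases hkS : k ∈ S
        · rw [(memS k).1 hkS, smul_zero] at hsum
          exact he0 hsum.symm
        · have h1 := hfac k hkS
          rw [if_pos rfl] at h1
          rw [show W.A i k = 1 by omega, one_smul] at hsum
          exact hk hsum
    ext j
    have := congrFun hx0 j
    simpa [ext] using this

end BerglundHubsch

/-! ### Holomorphic functions of several variables as limits -/

open Filter in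
/-- Weierstrass's theorem in several variables: a locally uniform limit of holomorphic functions is
holomorphic. Cauchy's estimate on complex lines makes the derivatives converge uniformly. -/
theorem TendstoLocallyUniformlyOn.differentiableOn_of_properSpace {E : Type*}
    [NormedAddCommGroup E] [NormedSpace ℂ E] [ProperSpace E] {U : Set E} (hU : IsOpen U)
    {f : ℕ → E → ℂ} {g : E → ℂ} (hf : ∀ n, DifferentiableOn ℂ (f n) U)
    (h : TendstoLocallyUniformlyOn f g atTop U) : DifferentiableOn ℂ g U := by
  intro x hx
  obtain ⟨r, hr, hball⟩ : ∃ r > 0, Metric.closedBall x (r + r) ⊆ U := by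
    obtain ⟨ε, hε, h⟩ := Metric.nhds_basis_closedBall.mem_iff.1 (hU.mem_nhds hx)
    exact ⟨ε / 2, by positivity, by rwa [add_halves]⟩
  have hunif : TendstoUniformlyOn f g atTop (Metric.closedBall x (r + r)) :=
    (tendstoLocallyUniformlyOn_iff_forall_isCompact hU).1 h _ hball (isCompact_closedBall _ _)
  have hsub {y : E} (hy : y ∈ Metric.ball x r) : Metric.closedBall y r ⊆
      Metric.closedBall x (r + r) := by
    refine Metric.closedBall_subset_closedBall' ?_
    have := Metric.mem_ball.1 hy
    linarith
  have hcauchy {F : E → ℂ} {C : ℝ} (hF : DifferentiableOn ℂ F U)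
      (hC : ∀ y ∈ Metric.closedBall x (r + r), ‖F y‖ ≤ C) {y : E} (hy : y ∈ Metric.ball x r) :
      ‖fderiv ℂ F y‖ ≤ C / r := by
    have hC0 : 0 ≤ C := (norm_nonneg _).trans (hC y (hsub hy (by simp [hr.le])))
    refine ContinuousLinearMap.opNorm_le_bound _ (by positivity) fun v => ?_
    rcases eq_or_ne v 0 with rfl | hv
    · simp
    have hv' : 0 < ‖v‖ := norm_pos_iff.2 hv
    have hmem {t : ℂ} (ht : t ∈ Metric.closedBall (0 : ℂ) (r / ‖v‖)) :
        y + t • v ∈ Metric.closedBall x (r + r) := by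
      refine hsub hy ?_
      rw [mem_closedBall_zero_iff, le_div_iff₀ hv'] at ht
      simpa [norm_smul] using ht
    have hdiff {t : ℂ} (ht : t ∈ Metric.closedBall (0 : ℂ) (r / ‖v‖)) :
        HasDerivAt (fun t : ℂ => F (y + t • v)) (fderiv ℂ F (y + t • v) v) t := by
      have h1 := (hF.differentiableAt (hU.mem_nhds (hball (hmem ht)))).hasFDerivAt
      have h2 : HasDerivAt (fun t : ℂ => y + t • v) v t := by
        simpa using ((hasDerivAt_id t).smul_const v).const_add y
      exact h1.comp_hasDerivAt t h2
    have h3 : DiffContOnCl ℂ (fun t : ℂ => F (y + t • v)) (Metric.ball 0 (r / ‖v‖)) := by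
      refine DifferentiableOn.diffContOnCl fun t ht => ?_
      have := hdiff (Metric.closure_ball_subset_closedBall ht)
      exact this.differentiableAt.differentiableWithinAt
    have h4 := Complex.norm_deriv_le_of_forall_mem_sphere_norm_le (div_pos hr hv') h3
      (fun t ht => hC _ (hmem (Metric.sphere_subset_closedBall ht)))
    have h5 := (hdiff (t := 0) (Metric.mem_closedBall_self (by positivity))).deriv
    simp only [zero_smul, add_zero] at h5
    rw [h5] at h4
    calc _ ≤ _ := h4
      _ = _ := by field_simp
  have hcs : UniformCauchySeqOn (fun n => fderiv ℂ (f n)) atTop (Metric.ball x r) := by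
    rw [Metric.uniformCauchySeqOn_iff]
    intro ε hε
    obtain ⟨N, hN⟩ := Metric.uniformCauchySeqOn_iff.1 hunif.uniformCauchySeqOn (ε / 2 * r)
      (by positivity)
    refine ⟨N, fun m hm n hn y hy => ?_⟩
    have hyU : y ∈ U := hball (hsub hy (by simp [hr.le]))
    have := hcauchy (F := fun y => f m y - f n y) (C := ε / 2 * r) ((hf m).sub (hf n))
      (fun y hy => by
        have := (hN m hm n hn y hy).le
        rwa [dist_eq_norm] at this) hy
    rw [fderiv_fun_sub ((hf m).differentiableAt (hU.mem_nhds hyU))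
      ((hf n).differentiableAt (hU.mem_nhds hyU)), mul_div_cancel_right₀ _ hr.ne'] at this
    rw [dist_eq_norm]
    linarith
  have hlim (y) (hy : y ∈ Metric.ball x r) : ∃ L, Tendsto (fun n => fderiv ℂ (f n) y) atTop (𝓝 L) :=
    cauchySeq_tendsto_of_complete (hcs.cauchySeq hy)
  choose! g' hg' using hlim
  refine (hasFDerivAt_of_tendstoUniformlyOn (f := f) Metric.isOpen_ball
    (hcs.tendstoUniformlyOn_of_tendsto hg') (fun n y hy => ?_) (fun y hy => ?_)
    (Metric.mem_ball_self hr)).differentiableAt.differentiableWithinAt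
  · exact ((hf n).differentiableAt (hU.mem_nhds (hball (hsub hy (by simp [hr.le]))))).hasFDerivAt
  · exact hunif.tendsto_at (hsub hy (by simp [hr.le]))

/-! ### Theta functions -/

namespace BerglundHubsch

/-- The infinite product `∏_{n ≥ 1} (1 - q ^ n x)`. -/
def qProd (x q : ℂ) : ℂ := ∏' n : ℕ, (1 - q ^ (n + 1) * x)

theorem summable_qProd (x : ℂ) {q : ℂ} (hq : ‖q‖ < 1) :
    Summable fun n : ℕ => ‖-(q ^ (n + 1) * x)‖ := by
  simp only [norm_neg, norm_mul, norm_pow]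
  exact ((summable_nat_add_iff 1).2 (summable_geometric_of_lt_one (norm_nonneg _) hq)).mul_right _

theorem multipliable_qProd (x : ℂ) {q : ℂ} (hq : ‖q‖ < 1) :
    Multipliable fun n : ℕ => 1 - q ^ (n + 1) * x := by
  simpa only [sub_eq_add_neg] using multipliable_one_add_of_summable (summable_qProd x hq)

theorem qProd_eq_mul (x : ℂ) {q : ℂ} (hq : ‖q‖ < 1) :
    qProd x q = (1 - q * x) * qProd (q * x) q := by
  rw [qProd, tprod_eq_zero_mul']
  · simp [qProd, pow_succ, mul_assoc]
  · simpa [pow_succ, mul_assoc] using multipliable_qProd (q * x) hq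

theorem qProd_ne_zero {x q : ℂ} (hq : ‖q‖ < 1) (h : ∀ n : ℕ, q ^ (n + 1) * x ≠ 1) :
    qProd x q ≠ 0 := by
  simp only [qProd, sub_eq_add_neg]
  refine tprod_one_add_ne_zero_of_summable (fun n h' => h n ?_) (summable_qProd x hq)
  linear_combination -h'

theorem norm_qProd_sub_one_le (x : ℂ) {q : ℂ} (hq : ‖q‖ < 1) :
    ‖qProd x q - 1‖ ≤ Real.exp (‖q * x‖ / (1 - ‖q‖)) - 1 := by
  have h1 := (multipliable_qProd x hq).hasProd.sub_const 1 |>.norm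
  refine le_of_tendsto h1 (Filter.Eventually.of_forall fun s => ?_)
  have h2 := Finset.norm_prod_one_add_sub_one_le s fun n : ℕ => -(q ^ (n + 1) * x)
  simp only [← sub_eq_add_neg] at h2
  refine h2.trans ?_
  gcongr
  refine ((summable_qProd x hq).sum_le_tsum s fun _ _ => norm_nonneg _).trans_eq ?_
  simp only [norm_neg, norm_mul, norm_pow]
  rw [tsum_mul_right]
  simp only [pow_succ, tsum_mul_right, tsum_geometric_of_lt_one (norm_nonneg q) hq]
  field_simp

theorem differentiableOn_qProd :
    DifferentiableOn ℂ (fun p : ℂ × ℂ => qProd p.1 p.2) {p | ‖p.2‖ < 1} := by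
  intro p hp
  obtain ⟨r, hr, hr1⟩ := exists_between (show ‖p.2‖ < 1 from hp)
  have hr0 : 0 ≤ r := (norm_nonneg _).trans hr.le
  set U : Set (ℂ × ℂ) := {y | ‖y.1‖ < ‖p.1‖ + 1 ∧ ‖y.2‖ < r}
  have hU : IsOpen U :=
    (isOpen_lt continuous_fst.norm continuous_const).inter
      (isOpen_lt continuous_snd.norm continuous_const)
  have h := Summable.hasProdLocallyUniformlyOn_nat_one_add
    (f := fun (n : ℕ) (y : ℂ × ℂ) => -(y.2 ^ (n + 1) * y.1)) hU
    (u := fun n => r ^ (n + 1) * (‖p.1‖ + 1))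
    (((summable_nat_add_iff 1).2 (summable_geometric_of_lt_one hr0 hr1)).mul_right _)
    (Filter.Eventually.of_forall fun n y hy => by
      rw [norm_neg, norm_mul, norm_pow]
      have := hy.1.le
      have := hy.2.le
      gcongr) (fun n => by fun_prop)
  have h' := h.tendstoLocallyUniformlyOn_finsetRange
  have := h'.differentiableOn_of_properSpace hU
    (fun n => Differentiable.differentiableOn fun y =>
      (HasFDerivAt.finsetProd (u := Finset.range n)
        (g := fun i (y : ℂ × ℂ) => 1 + -(y.2 ^ (i + 1) * y.1))
        fun i _ => DifferentiableAt.hasFDerivAt (by fun_prop)).differentiableAt)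
  have hd := this.differentiableAt (hU.mem_nhds (x := p) ⟨by simp, hr⟩)
  simp only [← sub_eq_add_neg] at hd
  exact hd.differentiableWithinAt

theorem norm_exp_two_pi_mul_I_lt_one {τ : ℂ} (hτ : 0 < τ.im) :
    ‖Complex.exp (2 * Real.pi * Complex.I * τ)‖ < 1 := by
  rw [Complex.norm_exp]
  simp [Real.pi_pos, hτ]

theorem Theta_eq (ν : ℂ) {τ : ℂ} (hτ : 0 < τ.im) :
    Theta ν τ = Complex.I * Complex.exp (2 * Real.pi * Complex.I * τ / 8) *
      Complex.exp (-(Complex.I * Real.pi * ν)) * (1 - Complex.exp (2 * Real.pi * Complex.I * ν)) *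
      (qProd 1 (Complex.exp (2 * Real.pi * Complex.I * τ)) *
        qProd (Complex.exp (2 * Real.pi * Complex.I * ν))
          (Complex.exp (2 * Real.pi * Complex.I * τ)) *
        qProd (Complex.exp (-(2 * Real.pi * Complex.I * ν)))
          (Complex.exp (2 * Real.pi * Complex.I * τ))) := by
  have hq := norm_exp_two_pi_mul_I_lt_one hτ
  rw [Theta]
  congr 1
  rw [Multipliable.tprod_mul, Multipliable.tprod_mul]
  · simp [qProd]
  · simpa using multipliable_qProd 1 hq
  · exact multipliable_qProd _ hq
  · refine Multipliable.mul ?_ (multipliable_qProd _ hq)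
    simpa using multipliable_qProd 1 hq
  · exact multipliable_qProd _ hq

theorem Theta_zero {τ : ℂ} (hτ : 0 < τ.im) : Theta 0 τ = 0 := by
  rw [Theta_eq _ hτ]
  simp

theorem Theta_add_one (ν : ℂ) {τ : ℂ} (hτ : 0 < τ.im) : Theta (ν + 1) τ = -Theta ν τ := by
  rw [Theta_eq _ hτ, Theta_eq _ hτ]
  have h1 : Complex.exp (2 * Real.pi * Complex.I * (ν + 1)) =
      Complex.exp (2 * Real.pi * Complex.I * ν) := by
    rw [mul_add, mul_one, Complex.exp_periodic]
  have h2 : Complex.exp (-(Complex.I * Real.pi * (ν + 1))) =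
      -Complex.exp (-(Complex.I * Real.pi * ν)) := by
    rw [show -(Complex.I * Real.pi * (ν + 1)) = -(Complex.I * Real.pi * ν) - Real.pi * Complex.I by
      ring, Complex.exp_sub_pi_mul_I]
  simp only [Complex.exp_neg, h1] at h2 ⊢
  rw [h2]
  ring

theorem Theta_add_tau (ν : ℂ) {τ : ℂ} (hτ : 0 < τ.im) :
    Theta (ν + τ) τ =
      -Complex.exp (-(Real.pi * Complex.I * (τ + 2 * ν))) * Theta ν τ := by
  have hq := norm_exp_two_pi_mul_I_lt_one hτ
  rw [Theta_eq _ hτ, Theta_eq _ hτ]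
  have e1 : Complex.exp (2 * Real.pi * Complex.I * (ν + τ)) =
      Complex.exp (2 * Real.pi * Complex.I * τ) * Complex.exp (2 * Real.pi * Complex.I * ν) := by
    rw [← Complex.exp_add]
    ring_nf
  have e2 : Complex.exp (-(2 * Real.pi * Complex.I * ν)) =
      Complex.exp (2 * Real.pi * Complex.I * τ) *
        Complex.exp (-(2 * Real.pi * Complex.I * (ν + τ))) := by
    rw [← Complex.exp_add]
    ring_nf
  have e3 : Complex.exp (-(Complex.I * Real.pi * (ν + τ))) =
      Complex.exp (-(Real.pi * Complex.I * (τ + 2 * ν))) *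
        Complex.exp (-(Complex.I * Real.pi * ν)) * Complex.exp (2 * Real.pi * Complex.I * ν) := by
    rw [← Complex.exp_add, ← Complex.exp_add]
    ring_nf
  have e4 : Complex.exp (2 * Real.pi * Complex.I * ν) *
      Complex.exp (-(2 * Real.pi * Complex.I * ν)) = 1 := by
    rw [← Complex.exp_add]
    simp
  have h1 := qProd_eq_mul (Complex.exp (2 * Real.pi * Complex.I * ν)) hq
  have h2 := qProd_eq_mul (Complex.exp (-(2 * Real.pi * Complex.I * (ν + τ)))) hq
  rw [← e2] at h2
  rw [h2, e1, e3, h1]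
  linear_combination (-Complex.I * Complex.exp (2 * Real.pi * Complex.I * τ / 8) *
    Complex.exp (-(Real.pi * Complex.I * (τ + 2 * ν))) * Complex.exp (-(Complex.I * Real.pi * ν)) *
    (1 - Complex.exp (2 * Real.pi * Complex.I * τ) * Complex.exp (2 * Real.pi * Complex.I * ν)) *
    qProd 1 (Complex.exp (2 * Real.pi * Complex.I * τ)) *
    qProd (Complex.exp (2 * Real.pi * Complex.I * τ) * Complex.exp (2 * Real.pi * Complex.I * ν))
      (Complex.exp (2 * Real.pi * Complex.I * τ)) *
    qProd (Complex.exp (-(2 * Real.pi * Complex.I * ν)))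
      (Complex.exp (2 * Real.pi * Complex.I * τ))) * e4

theorem Theta_tau_add_one (ν : ℂ) {τ : ℂ} (hτ : 0 < τ.im) :
    Theta ν (τ + 1) = Complex.exp (Real.pi * Complex.I / 4) * Theta ν τ := by
  rw [Theta_eq _ hτ, Theta_eq _ (by simpa using hτ)]
  rw [show 2 * Real.pi * Complex.I * (τ + 1) / 8 =
    2 * Real.pi * Complex.I * τ / 8 + Real.pi * Complex.I / 4 by ring, mul_add, mul_one,
    Complex.exp_periodic, Complex.exp_add]
  ring

theorem Theta_add_int (ν : ℂ) {τ : ℂ} (hτ : 0 < τ.im) (n : ℤ) :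
    Theta (ν + n) τ = Complex.exp (Real.pi * Complex.I * n) * Theta ν τ := by
  have step (n : ℤ) : Theta (ν + (n + 1 : ℤ)) τ =
        Complex.exp (Real.pi * Complex.I * (n + 1 : ℤ)) * Theta ν τ ↔
      Theta (ν + n) τ = Complex.exp (Real.pi * Complex.I * n) * Theta ν τ := by
    push_cast
    rw [← add_assoc, Theta_add_one _ hτ, mul_add, mul_one, Complex.exp_add_pi_mul_I, neg_mul,
      neg_inj]
  induction n with
  | zero => simp
  | succ n ih => exact (step n).2 ih
  | pred n ih => exact (step _).1 (by simpa using ih)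

theorem Theta_add_int_mul_tau (ν : ℂ) {τ : ℂ} (hτ : 0 < τ.im) (m : ℤ) :
    Theta (ν + m * τ) τ =
      Complex.exp (Real.pi * Complex.I * (m - m ^ 2 * τ - 2 * m * ν)) * Theta ν τ := by
  have step (m : ℤ) : Theta (ν + (m + 1 : ℤ) * τ) τ =
        Complex.exp (Real.pi * Complex.I *
          ((m + 1 : ℤ) - (m + 1 : ℤ) ^ 2 * τ - 2 * (m + 1 : ℤ) * ν)) *
          Theta ν τ ↔
      Theta (ν + m * τ) τ =
        Complex.exp (Real.pi * Complex.I * (m - m ^ 2 * τ - 2 * m * ν)) * Theta ν τ := by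
    push_cast
    have h : Complex.exp (Real.pi * Complex.I * (m + 1 - (m + 1) ^ 2 * τ - 2 * (m + 1) * ν)) =
        -Complex.exp (-(Real.pi * Complex.I * (τ + 2 * (ν + m * τ)))) *
          Complex.exp (Real.pi * Complex.I * (m - m ^ 2 * τ - 2 * m * ν)) := by
      rw [neg_mul, ← Complex.exp_add, ← Complex.exp_add_pi_mul_I]
      ring_nf
    rw [show ν + ((m : ℂ) + 1) * τ = ν + m * τ + τ by ring, Theta_add_tau _ hτ, h, mul_assoc (-_)]
    exact mul_right_inj' (neg_ne_zero.2 (Complex.exp_ne_zero _))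
  induction m with
  | zero => simp
  | succ n ih => exact (step n).2 ih
  | pred n ih => exact (step _).1 (by simpa using ih)

/-- The factor by which `Θ(·, τ)` changes under translation by `m τ + n`. -/
def thetaFactor (m n : ℤ) (ν τ : ℂ) : ℂ :=
  Complex.exp (Real.pi * Complex.I * (n + m - m ^ 2 * τ - 2 * m * ν))

theorem Theta_add_lattice (ν : ℂ) {τ : ℂ} (hτ : 0 < τ.im) (m n : ℤ) :
    Theta (ν + m * τ + n) τ = thetaFactor m n ν τ * Theta ν τ := by
  rw [Theta_add_int _ hτ, Theta_add_int_mul_tau _ hτ, ← mul_assoc, ← Complex.exp_add, thetaFactor]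
  ring_nf

theorem Theta_ne_zero {ν τ : ℂ} (hτ : 0 < τ.im) (h : ∀ m n : ℤ, ν ≠ m * τ + n) :
    Theta ν τ ≠ 0 := by
  have hq := norm_exp_two_pi_mul_I_lt_one hτ
  have hpi : (2 * Real.pi * Complex.I : ℂ) ≠ 0 := Complex.two_pi_I_ne_zero
  have key (m : ℤ) (w : ℂ) (hw : w = m * τ + ν ∨ w = m * τ - ν) :
      Complex.exp (2 * Real.pi * Complex.I * w) ≠ 1 := by
    rw [Ne, Complex.exp_eq_one_iff]
    rintro ⟨n, hn⟩
    rw [mul_comm (n : ℂ), mul_right_inj' hpi] at hn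
    rcases hw with rfl | rfl
    · exact h (-m) n (by push_cast; linear_combination hn)
    · exact h m (-n) (by push_cast; linear_combination -hn)
  have hpow (n : ℕ) (w : ℂ) : Complex.exp (2 * Real.pi * Complex.I * τ) ^ (n + 1) *
      Complex.exp (2 * Real.pi * Complex.I * w) =
      Complex.exp (2 * Real.pi * Complex.I * ((n + 1 : ℤ) * τ + w)) := by
    rw [← Complex.exp_nat_mul, ← Complex.exp_add]
    push_cast
    ring_nf
  rw [Theta_eq _ hτ]
  refine mul_ne_zero (mul_ne_zero (mul_ne_zero
    (mul_ne_zero Complex.I_ne_zero (Complex.exp_ne_zero _))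
    (Complex.exp_ne_zero _)) ?_) (mul_ne_zero (mul_ne_zero ?_ ?_) ?_)
  · exact sub_ne_zero.2 (key 0 ν (by simp)).symm
  · refine qProd_ne_zero hq fun n h => ?_
    have := congrArg norm h
    rw [mul_one, norm_pow, norm_one] at this
    exact (pow_lt_one₀ (norm_nonneg _) hq (by simp)).ne this
  · refine qProd_ne_zero hq fun n => ?_
    rw [hpow]
    exact key _ _ (.inl rfl)
  · refine qProd_ne_zero hq fun n => ?_
    rw [← mul_neg, hpow]
    exact key _ _ (.inr (by ring))

/-- The quotient `Θ(ν, τ) / ν`, holomorphic also at `ν = 0`. -/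
def thetaDiv (ν τ : ℂ) : ℂ :=
  Complex.I * Complex.exp (2 * Real.pi * Complex.I * τ / 8) *
      Complex.exp (-(Complex.I * Real.pi * ν)) *
      dslope (fun w => 1 - Complex.exp (2 * Real.pi * Complex.I * w)) 0 ν *
      (qProd 1 (Complex.exp (2 * Real.pi * Complex.I * τ)) *
        qProd (Complex.exp (2 * Real.pi * Complex.I * ν))
          (Complex.exp (2 * Real.pi * Complex.I * τ)) *
        qProd (Complex.exp (-(2 * Real.pi * Complex.I * ν)))
          (Complex.exp (2 * Real.pi * Complex.I * τ)))

theorem Theta_eq_mul_thetaDiv (ν : ℂ) {τ : ℂ} (hτ : 0 < τ.im) : Theta ν τ = ν * thetaDiv ν τ := by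
  have h := sub_smul_dslope (fun w => 1 - Complex.exp (2 * Real.pi * Complex.I * w)) 0 ν
  simp only [sub_zero, smul_eq_mul, mul_zero, Complex.exp_zero, sub_self] at h
  rw [Theta_eq _ hτ, ← h, thetaDiv]
  ring

theorem thetaDiv_zero_ne_zero {τ : ℂ} (hτ : 0 < τ.im) : thetaDiv 0 τ ≠ 0 := by
  have hq := norm_exp_two_pi_mul_I_lt_one hτ
  have hQ : qProd 1 (Complex.exp (2 * Real.pi * Complex.I * τ)) ≠ 0 := by
    refine qProd_ne_zero hq fun n h => ?_
    have := congrArg norm h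
    rw [mul_one, norm_pow, norm_one] at this
    exact (pow_lt_one₀ (norm_nonneg _) hq (by simp)).ne this
  have hd : HasDerivAt (fun w => 1 - Complex.exp (2 * Real.pi * Complex.I * w))
      (-(2 * Real.pi * Complex.I)) 0 := by
    have := (((hasDerivAt_id (0 : ℂ)).const_mul (2 * Real.pi * Complex.I)).cexp).const_sub 1
    simpa using this
  simp [thetaDiv, dslope_same, hd.deriv, hQ, Complex.exp_ne_zero, Real.pi_ne_zero]

theorem differentiableOn_thetaDiv :
    DifferentiableOn ℂ (fun p : ℂ × ℂ => thetaDiv p.1 p.2) {p | 0 < p.2.im} := by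
  have hQ (f : ℂ × ℂ → ℂ) (hf : Differentiable ℂ f) : DifferentiableOn ℂ
      (fun p : ℂ × ℂ => qProd (f p) (Complex.exp (2 * Real.pi * Complex.I * p.2)))
      {p | 0 < p.2.im} := by
    refine differentiableOn_qProd.comp (f := fun p : ℂ × ℂ =>
      (f p, Complex.exp (2 * Real.pi * Complex.I * p.2))) ?_ fun p hp => ?_
    · fun_prop
    · exact norm_exp_two_pi_mul_I_lt_one hp
  have hs : Differentiable ℂ
      (dslope (fun w => 1 - Complex.exp (2 * Real.pi * Complex.I * w)) 0) := by
    rw [← differentiableOn_univ, Complex.differentiableOn_dslope Filter.univ_mem]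
    fun_prop
  unfold thetaDiv
  refine DifferentiableOn.mul (DifferentiableOn.mul (by fun_prop) ?_)
    (DifferentiableOn.mul (DifferentiableOn.mul (hQ _ (by fun_prop)) (hQ _ (by fun_prop)))
      (hQ _ (by fun_prop)))
  exact (hs.comp differentiable_fst).differentiableOn

theorem differentiableOn_Theta :
    DifferentiableOn ℂ (fun p : ℂ × ℂ => Theta p.1 p.2) {p | 0 < p.2.im} :=
  (differentiableOn_fst.mul differentiableOn_thetaDiv).congr fun p hp =>
    Theta_eq_mul_thetaDiv p.1 hp

/-! ### Fourier expansion of periodic holomorphic functions -/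

/-- The `n`-th Fourier coefficient of a `1`-periodic function `g`, that is, the coefficient of
`exp (2 π i n z)`, computed on the line `Im z = y`. -/
def lineCoeff (g : ℂ → ℂ) (y : ℝ) (n : ℤ) : ℂ :=
  ∫ x in (0 : ℝ)..1, g (x + y * Complex.I) *
    Complex.exp (-(2 * Real.pi * Complex.I * n * (x + y * Complex.I)))

theorem lineCoeff_eq_of_periodic {a y₁ y₂ : ℝ} {g : ℂ → ℂ}
    (hg : DifferentiableOn ℂ g {z | a < z.im})
    (hper : ∀ z, a < z.im → g (z + 1) = g z) (h₁ : a < y₁) (h₂ : a < y₂) (n : ℤ) :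
    lineCoeff g y₁ n = lineCoeff g y₂ n := by
  have h := Complex.integral_boundary_rect_eq_zero_of_differentiableOn
    (fun z => g z * Complex.exp (-(2 * Real.pi * Complex.I * n * z))) (y₁ * Complex.I)
    (1 + y₂ * Complex.I) ?_
  · have hside : ∀ y ∈ Set.uIcc y₁ y₂,
        g (1 + y * Complex.I) * Complex.exp (-(2 * Real.pi * Complex.I * n * (1 + y * Complex.I))) =
        g (y * Complex.I) * Complex.exp (-(2 * Real.pi * Complex.I * n * (y * Complex.I))) := by
      intro y hy
      have hy' : a < y := (lt_min h₁ h₂).trans_le hy.1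
      rw [add_comm 1, hper _ (by simpa using hy')]
      congr 1
      rw [Complex.exp_eq_exp_iff_exists_int]
      exact ⟨-n, by push_cast; ring⟩
    have hint := intervalIntegral.integral_congr (μ := MeasureTheory.volume) hside
    simp at h hint
    rw [hint, add_sub_cancel_right, sub_eq_zero] at h
    simpa [lineCoeff] using h
  · refine (hg.mono fun z hz => ?_).mul (by fun_prop)
    have := hz.2
    simp at this
    exact (lt_min h₁ h₂).trans_le this.1

theorem norm_lineCoeff_le {g : ℂ → ℂ} {y M : ℝ}
    (hM : ∀ x : ℝ, x ∈ Set.Icc (0 : ℝ) 1 → ‖g (x + y * Complex.I)‖ ≤ M) (n : ℤ) :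
    ‖lineCoeff g y n‖ ≤ M * Real.exp (2 * Real.pi * n * y) := by
  refine (intervalIntegral.norm_integral_le_of_norm_le_const
    (C := M * Real.exp (2 * Real.pi * n * y))
    fun x hx => ?_).trans_eq (by simp)
  rw [Set.uIoc_of_le zero_le_one] at hx
  rw [norm_mul, Complex.norm_exp]
  have : (-(2 * Real.pi * Complex.I * n * (x + y * Complex.I))).re = 2 * Real.pi * n * y := by
    simp
  rw [this]
  gcongr
  exact hM x ⟨hx.1.le, hx.2⟩

theorem hasSum_lineCoeff {g : ℂ → ℂ} {y : ℝ} (hc : Continuous fun x : ℝ => g (x + y * Complex.I))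
    (hper : ∀ x : ℝ, g (x + y * Complex.I + 1) = g (x + y * Complex.I))
    (hs : Summable fun n : ℤ => lineCoeff g y n * Complex.exp (-(2 * Real.pi * n * y))) (x : ℝ) :
    HasSum (fun n : ℤ => lineCoeff g y n *
      Complex.exp (2 * Real.pi * Complex.I * n * (x + y * Complex.I))) (g (x + y * Complex.I)) := by
  set φ : ℝ → ℂ := fun x => g (x + y * Complex.I) with hφ
  have hp : Function.Periodic φ 1 := fun x => by
    simp only [hφ]
    rw [← hper x]
    push_cast
    ring_nf
  let F : C(AddCircle (1 : ℝ), ℂ) := ⟨hp.lift, hc.quotient_lift _⟩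
  have hF (x : ℝ) : F (x : AddCircle (1 : ℝ)) = φ x := hp.lift_coe x
  have hcoef (n : ℤ) :
      fourierCoeff F n = lineCoeff g y n * Complex.exp (-(2 * Real.pi * n * y)) := by
    rw [fourierCoeff_eq_intervalIntegral F n 0, lineCoeff, ← intervalIntegral.integral_mul_const]
    simp only [hF, fourier_coe_apply, div_one, one_smul, zero_add, smul_eq_mul]
    refine intervalIntegral.integral_congr fun x _ => ?_
    simp only [hφ]
    rw [mul_assoc (g _), ← Complex.exp_add, mul_comm]
    congr 2
    push_cast
    linear_combination (2 * Real.pi * n * y) * Complex.I_sq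
  have hs' : Summable (fourierCoeff F) := hs.congr fun n => (hcoef n).symm
  have h := has_pointwise_sum_fourier_series_of_summable hs' x
  rw [hF] at h
  convert h using 2 with n
  rw [hcoef, fourier_coe_apply, smul_eq_mul, mul_assoc (lineCoeff _ _ _), ← Complex.exp_add]
  congr 2
  push_cast
  linear_combination (2 * Real.pi * n * y) * Complex.I_sq

theorem summable_exp_neg_mul_abs {b : ℝ} (hb : 0 < b) :
    Summable fun n : ℤ => Real.exp (-(b * |(n : ℝ)|)) := by
  have h : Summable fun n : ℕ => Real.exp (-(b * (n : ℝ))) := by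
    simpa [mul_comm] using Real.summable_exp_nat_mul_iff.2 (neg_neg_of_pos hb)
  exact Summable.of_nat_of_neg (by simpa using h) (by simpa using h)

section TwoVariables

variable {F : ℂ → ℂ → ℂ}

/-- The Fourier coefficient of `exp (2 π i n τ) exp (2 π i l z)` of a function that is `1`-periodic
in `z` and `τ`, computed on the torus `Im z = y`, `Im τ = t`. -/
def torusCoeff (F : ℂ → ℂ → ℂ) (y t : ℝ) (n l : ℤ) : ℂ :=
  lineCoeff (fun τ => lineCoeff (fun z => F z τ) y l) t n

theorem continuous_comp_lines
    (hF : DifferentiableOn ℂ (fun p : ℂ × ℂ => F p.1 p.2) {p | 0 < p.2.im})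
    (y : ℝ) {t : ℝ} (ht : 0 < t) :
    Continuous fun p : ℝ × ℝ => F (p.1 + y * Complex.I) (p.2 + t * Complex.I) := by
  have h : Continuous fun p : ℝ × ℝ => ((p.1 + y * Complex.I, p.2 + t * Complex.I) : ℂ × ℂ) := by
    fun_prop
  exact hF.continuousOn.comp_continuous h (by simp [ht])

theorem torusCoeff_swap (hF : DifferentiableOn ℂ (fun p : ℂ × ℂ => F p.1 p.2) {p | 0 < p.2.im})
    (y : ℝ) {t : ℝ} (ht : 0 < t) (n l : ℤ) :
    torusCoeff F y t n l = lineCoeff (fun z => lineCoeff (F z) t n) y l := by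
  simp only [torusCoeff, lineCoeff, ← intervalIntegral.integral_mul_const]
  rw [MeasureTheory.intervalIntegral_intervalIntegral_swap]
  · refine intervalIntegral.integral_congr fun x _ => intervalIntegral.integral_congr fun s _ => ?_
    ring
  · have hc := continuous_comp_lines hF y ht
    have hc' : Continuous fun p : ℝ × ℝ => F (p.2 + y * Complex.I) (p.1 + t * Complex.I) :=
      hc.comp continuous_swap
    have : Continuous (Function.uncurry fun s x : ℝ => F (x + y * Complex.I) (s + t * Complex.I) *
        Complex.exp (-(2 * Real.pi * Complex.I * l * (x + y * Complex.I))) *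
        Complex.exp (-(2 * Real.pi * Complex.I * n * (s + t * Complex.I)))) := by
      exact (hc'.mul (by fun_prop)).mul (by fun_prop)
    exact (this.continuousOn.integrableOn_compact (isCompact_uIcc.prod isCompact_uIcc)).mono_set
      (Set.prod_mono Set.uIoc_subset_uIcc Set.uIoc_subset_uIcc)

variable (hF : DifferentiableOn ℂ (fun p : ℂ × ℂ => F p.1 p.2) {p | 0 < p.2.im})
  (hz : ∀ z τ, 0 < τ.im → F (z + 1) τ = F z τ) (hτ : ∀ z τ, 0 < τ.im → F z (τ + 1) = F z τ)

include hF hz hτ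

theorem torusCoeff_eq (y₁ y₂ : ℝ) {t₁ t₂ : ℝ} (h₁ : 0 < t₁) (h₂ : 0 < t₂) (n l : ℤ) :
    torusCoeff F y₁ t₁ n l = torusCoeff F y₂ t₂ n l := by
  have hy : torusCoeff F y₁ t₁ n l = torusCoeff F y₂ t₁ n l := by
    rw [torusCoeff, torusCoeff, lineCoeff, lineCoeff]
    refine intervalIntegral.integral_congr fun s _ => ?_
    have hs : 0 < (s + t₁ * Complex.I : ℂ).im := by simpa using h₁
    congr 1
    refine lineCoeff_eq_of_periodic (a := min y₁ y₂ - 1) ?_ (fun z _ => hz z _ hs) ?_ ?_ l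
    · exact (hF.comp (f := fun z : ℂ => (z, (s + t₁ * Complex.I : ℂ))) (s := Set.univ) (by fun_prop)
        fun z _ => hs).mono (Set.subset_univ _)
    · linarith [min_le_left y₁ y₂]
    · linarith [min_le_right y₁ y₂]
  rw [hy, torusCoeff_swap hF y₂ h₁, torusCoeff_swap hF y₂ h₂, lineCoeff, lineCoeff]
  refine intervalIntegral.integral_congr fun x _ => ?_
  congr 1
  refine lineCoeff_eq_of_periodic (a := 0) ?_ (fun τ h => hτ _ τ h) h₁ h₂ n
  exact hF.comp (f := fun τ : ℂ => ((x + y₂ * Complex.I : ℂ), τ)) (by fun_prop) fun τ h => h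

omit hF hz hτ in
theorem norm_torusCoeff_le {y t M : ℝ}
    (hM : ∀ x ∈ Set.Icc (0 : ℝ) 1, ∀ s ∈ Set.Icc (0 : ℝ) 1,
      ‖F (x + y * Complex.I) (s + t * Complex.I)‖ ≤ M) (n l : ℤ) :
    ‖torusCoeff F y t n l‖ ≤ M * Real.exp (2 * Real.pi * l * y) * Real.exp (2 * Real.pi * n * t) :=
  norm_lineCoeff_le (fun s hs => norm_lineCoeff_le (fun x hx => hM x hx s hs) l) n

/-- A holomorphic function that is `1`-periodic in both variables is the sum of its Fourier series,
which converges absolutely at `(z, τ)`: the coefficients can be estimated on the tori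
`Im z' = Im z ± 1`, `Im τ' = Im τ ± Im τ / 2`. -/
theorem hasSum_torusCoeff (y₀ : ℝ) {t₀ : ℝ} (ht₀ : 0 < t₀) (z τ : ℂ) (h : 0 < τ.im) :
    HasSum (fun p : ℤ × ℤ => torusCoeff F y₀ t₀ p.1 p.2 *
      Complex.exp (2 * Real.pi * Complex.I * p.1 * τ) *
      Complex.exp (2 * Real.pi * Complex.I * p.2 * z)) (F z τ) := by
  set y := z.im
  set t := τ.im
  have hze : (z.re + y * Complex.I : ℂ) = z := Complex.re_add_im z
  have hτe : (τ.re + t * Complex.I : ℂ) = τ := Complex.re_add_im τ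
  have hcoef (y' t' : ℝ) (ht' : 0 < t') (n l : ℤ) :
      torusCoeff F y₀ t₀ n l = torusCoeff F y' t' n l := torusCoeff_eq hF hz hτ _ _ ht₀ ht' n l
  obtain ⟨M, hM⟩ : ∃ M, ∀ x ∈ Set.Icc (0 : ℝ) 1, ∀ s ∈ Set.Icc (0 : ℝ) 1,
      ∀ y' ∈ Set.Icc (y - 1) (y + 1), ∀ t' ∈ Set.Icc (t / 2) (t + t / 2),
      ‖F (x + y' * Complex.I) (s + t' * Complex.I)‖ ≤ M := by
    have hK : IsCompact ((Set.Icc (0 : ℝ) 1 ×ℂ Set.Icc (y - 1) (y + 1)) ×ˢ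
        (Set.Icc (0 : ℝ) 1 ×ℂ Set.Icc (t / 2) (t + t / 2))) :=
      (isCompact_Icc.reProdIm isCompact_Icc).prod (isCompact_Icc.reProdIm isCompact_Icc)
    obtain ⟨M, hM⟩ := hK.exists_bound_of_continuousOn (hF.continuousOn.mono fun p hp => by
      have := hp.2.2.1
      simp only [Set.mem_ofPred_eq]
      linarith)
    refine ⟨M, fun x hx s hs y' hy' t' ht' => hM (x + y' * Complex.I, s + t' * Complex.I) ?_⟩
    simp only [Set.mem_prod, Complex.mem_reProdIm]
    simp [hx.1, hx.2, hs.1, hs.2, hy'.1, hy'.2, ht'.1, ht'.2] at *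
  -- A shift against the sign of `n` gains the factor `exp (-2 π |n| r)` in the estimate on the
  -- `n`-th coefficient.
  have hsign (n : ℤ) (r : ℝ) (hr : 0 ≤ r) :
      ∃ r' ∈ Set.Icc (-r) r, (n : ℝ) * r' = -(|(n : ℝ)| * r) := by
    rcases le_total 0 (n : ℝ) with hn | hn
    · exact ⟨-r, ⟨le_rfl, by linarith⟩, by rw [abs_of_nonneg hn]; ring⟩
    · exact ⟨r, ⟨by linarith, le_rfl⟩, by rw [abs_of_nonpos hn]; ring⟩
  have hbound (n l : ℤ) : ‖torusCoeff F y₀ t₀ n l * Complex.exp (2 * Real.pi * Complex.I * n * τ) *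
      Complex.exp (2 * Real.pi * Complex.I * l * z)‖ ≤
      M * (Real.exp (-(Real.pi * t * |(n : ℝ)|)) * Real.exp (-(2 * Real.pi * |(l : ℝ)|))) := by
    obtain ⟨r, hr, hr'⟩ := hsign n (t / 2) (by positivity)
    obtain ⟨u, hu, hu'⟩ := hsign l 1 zero_le_one
    have h1 := norm_torusCoeff_le (F := F) (y := y + u) (t := t + r) (M := M) (fun x hx s hs =>
      hM x hx s hs _ ⟨by linarith [hu.1], by linarith [hu.2]⟩ _
        ⟨by linarith [hr.1], by linarith [hr.2]⟩)
      n l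
    rw [← hcoef (y + u) (t + r) (by linarith [hr.1])] at h1
    rw [norm_mul, norm_mul, Complex.norm_exp, Complex.norm_exp]
    have e1 : (2 * Real.pi * Complex.I * n * τ : ℂ).re = -(2 * Real.pi * n * t) := by simp [t]
    have e2 : (2 * Real.pi * Complex.I * l * z : ℂ).re = -(2 * Real.pi * l * y) := by simp [y]
    rw [e1, e2]
    calc _ ≤ M * Real.exp (2 * Real.pi * l * (y + u)) * Real.exp (2 * Real.pi * n * (t + r)) *
          Real.exp (-(2 * Real.pi * n * t)) * Real.exp (-(2 * Real.pi * l * y)) := by gcongr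
      _ = _ := by
        simp only [mul_assoc, ← Real.exp_add]
        congr 2
        linear_combination (2 * Real.pi) * hr' + (2 * Real.pi) * hu'
  have hsum : Summable fun p : ℤ × ℤ => torusCoeff F y₀ t₀ p.1 p.2 *
      Complex.exp (2 * Real.pi * Complex.I * p.1 * τ) *
      Complex.exp (2 * Real.pi * Complex.I * p.2 * z) := by
    refine Summable.of_norm_bounded ?_ fun p => hbound p.1 p.2
    exact ((summable_exp_neg_mul_abs (b := Real.pi * t) (by positivity)).mul_of_nonneg
      (summable_exp_neg_mul_abs (b := 2 * Real.pi) (by positivity))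
      (fun n => (Real.exp_pos _).le) fun l => (Real.exp_pos _).le).mul_left M
  -- The sum of the double series is evaluated by summing over the powers of `exp (2 π i τ)` first.
  have hsum' := (Equiv.prodComm ℤ ℤ).summable_iff.2 hsum
  have hinner (l : ℤ) : HasSum (fun n : ℤ => torusCoeff F y₀ t₀ n l *
      Complex.exp (2 * Real.pi * Complex.I * n * τ) * Complex.exp (2 * Real.pi * Complex.I * l * z))
      (lineCoeff (fun z => F z τ) y l * Complex.exp (2 * Real.pi * Complex.I * l * z)) := by
    refine HasSum.mul_right _ ?_
    have hs : Summable fun n : ℤ => torusCoeff F y t n l *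
        Complex.exp (2 * Real.pi * Complex.I * n * τ) := by
      have := hsum'.prod_factor l
      simp only [Function.comp_def, Equiv.prodComm_apply, Prod.fst_swap, Prod.snd_swap] at this
      rw [summable_mul_right_iff (Complex.exp_ne_zero _)] at this
      simpa only [hcoef y t h] using this
    have := hasSum_lineCoeff (g := fun τ => lineCoeff (fun z => F z τ) y l) (y := t) ?_ ?_ ?_ τ.re
    · simp only [hτe] at this
      simp only [hcoef y t h]
      exact this
    · refine intervalIntegral.continuous_parametric_intervalIntegral_of_continuous'
        (f := fun (s x : ℝ) => F (x + y * Complex.I) (s + t * Complex.I) *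
          Complex.exp (-(2 * Real.pi * Complex.I * l * (x + y * Complex.I)))) ?_ 0 1
      have hc' : Continuous fun p : ℝ × ℝ => F (p.2 + y * Complex.I) (p.1 + t * Complex.I) :=
        (continuous_comp_lines hF y h).comp continuous_swap
      exact hc'.mul (by fun_prop)
    · intro s
      refine congrArg (fun g => lineCoeff g y l) (funext fun w => ?_)
      exact hτ _ _ (by simpa using h)
    · refine Summable.of_norm (hs.norm.congr fun n => ?_)
      rw [norm_mul, norm_mul, Complex.norm_exp, Complex.norm_exp]
      congr 2
      simp [t]
  have houter : HasSum (fun l : ℤ => lineCoeff (fun z => F z τ) y l *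
      Complex.exp (2 * Real.pi * Complex.I * l * z)) (F z τ) := by
    have hs : Summable fun l : ℤ => lineCoeff (fun z => F z τ) y l *
        Complex.exp (2 * Real.pi * Complex.I * l * z) :=
      (hsum'.hasSum.prod_fiberwise hinner).summable
    have := hasSum_lineCoeff (g := fun z => F z τ) (y := y) ?_ (fun x => hz _ _ h) ?_ z.re
    · simpa only [hze] using this
    · have := (continuous_comp_lines hF y h).comp (f := fun x : ℝ => (x, τ.re)) (by fun_prop)
      simpa only [Function.comp_def, hτe] using this
    · refine Summable.of_norm (hs.norm.congr fun n => ?_)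
      rw [norm_mul, norm_mul, Complex.norm_exp, Complex.norm_exp]
      congr 2
      simp [y]
  have := hsum'.hasSum.prod_fiberwise hinner
  rw [← (Equiv.prodComm ℤ ℤ).hasSum_iff, houter.unique this]
  exact hsum'.hasSum

end TwoVariables

/-! ### The inversion formula for the theta function -/

/-- An entire function with the quasi-periodicity of `Θ(·, τ)` vanishes as soon as one of its
Fourier coefficients does, since quasi-periodicity under `τ` is a recursion for the coefficients.
-/
theorem eq_zero_of_lineCoeff_eq_zero {τ : ℂ} {g : ℂ → ℂ} (hg : Differentiable ℂ g)
    (h1 : ∀ ν, g (ν + 1) = g ν)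
    (h2 : ∀ ν, g (ν + τ) = -Complex.exp (-(2 * Real.pi * Complex.I * (τ + ν))) * g ν)
    (h0 : lineCoeff g 0 0 = 0) : g = 0 := by
  have hindep (y₁ y₂ : ℝ) (n : ℤ) : lineCoeff g y₁ n = lineCoeff g y₂ n :=
    lineCoeff_eq_of_periodic (a := min y₁ y₂ - 1) hg.differentiableOn (fun z _ => h1 z)
      (by linarith [min_le_left y₁ y₂]) (by linarith [min_le_right y₁ y₂]) n
  have hrec (n : ℤ) : lineCoeff g 0 n =
      -Complex.exp (-(2 * Real.pi * Complex.I * ((n + 1 : ℤ) * τ))) * lineCoeff g 0 (n + 1) := by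
    set φ : ℝ → ℂ := fun x => g (x + τ.im * Complex.I) *
      Complex.exp (-(2 * Real.pi * Complex.I * n * (x + τ.im * Complex.I))) with hφ
    have hper : Function.Periodic φ 1 := by
      intro x
      simp only [hφ]
      rw [show ((x + 1 : ℝ) + τ.im * Complex.I : ℂ) = x + τ.im * Complex.I + 1 by
        push_cast; ring, h1]
      congr 1
      rw [Complex.exp_eq_exp_iff_exists_int]
      exact ⟨-n, by push_cast; ring⟩
    -- Moving the segment of integration at height `Im τ` by `Re τ` makes it the translate of
    -- `[0, 1]` by `τ`, where `h2` applies.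
    have h3 := hper.intervalIntegral_add_eq 0 τ.re
    rw [hindep 0 τ.im, lineCoeff, lineCoeff, ← intervalIntegral.integral_const_mul]
    rw [zero_add] at h3
    rw [h3, add_comm τ.re 1, ← zero_add τ.re, ← add_assoc,
      ← intervalIntegral.integral_comp_add_right φ]
    simp only [add_zero]
    refine intervalIntegral.integral_congr fun x _ => ?_
    have e : (((x + τ.re : ℝ) : ℂ) + τ.im * Complex.I) = x + τ := by
      conv_rhs => rw [← Complex.re_add_im τ]
      push_cast
      ring
    simp only [hφ, e, h2, Complex.ofReal_zero, zero_mul, add_zero]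
    have e' : Complex.exp (-(2 * Real.pi * Complex.I * (τ + x))) *
        Complex.exp (-(2 * Real.pi * Complex.I * n * (x + τ))) =
        Complex.exp (-(2 * Real.pi * Complex.I * ((n + 1 : ℤ) * τ))) *
        Complex.exp (-(2 * Real.pi * Complex.I * (n + 1 : ℤ) * x)) := by
      rw [← Complex.exp_add, ← Complex.exp_add]
      push_cast
      ring_nf
    linear_combination (-g x) * e'
  have hall (n : ℤ) : lineCoeff g 0 n = 0 := by
    have step (n : ℤ) : lineCoeff g 0 n = 0 ↔ lineCoeff g 0 (n + 1) = 0 := by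
      rw [hrec n, mul_eq_zero, or_iff_right (neg_ne_zero.2 (Complex.exp_ne_zero _))]
    induction n with
    | zero => exact h0
    | succ n ih => exact (step n).1 ih
    | pred n ih => exact (step _).2 (by simpa using ih)
  ext z
  have hc : Continuous fun x : ℝ => g (x + z.im * Complex.I) := hg.continuous.comp (by fun_prop)
  have h3 (n : ℤ) : lineCoeff g z.im n = 0 := (hindep _ _ n).trans (hall n)
  have := hasSum_lineCoeff hc (fun x => h1 _) (by simp [h3, summable_zero]) z.re
  simp only [h3, zero_mul, Complex.re_add_im] at this
  exact this.unique hasSum_zero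

theorem im_neg_one_div_pos {τ : ℂ} (hτ : 0 < τ.im) : 0 < (-1 / τ).im := by
  have hτ0 : τ ≠ 0 := by
    rintro rfl
    simp at hτ
  rw [neg_div, one_div, Complex.neg_im, Complex.inv_im, neg_div, neg_neg]
  exact div_pos hτ (Complex.normSq_pos.2 hτ0)

/-- The behaviour of `Θ` under `τ ↦ -1 / τ`, up to a constant that depends on `τ` only: both sides
have the same quasi-periodicity in `ν`, and such functions form a space of dimension one. -/
theorem exists_Theta_inversion {τ : ℂ} (hτ : 0 < τ.im) :
    ∃ C : ℂ, C ≠ 0 ∧ ∀ ν,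
      Theta (ν / τ) (-1 / τ) = C * Complex.exp (Real.pi * Complex.I * ν ^ 2 / τ) * Theta ν τ := by
  have hτ0 : τ ≠ 0 := by
    rintro rfl
    simp at hτ
  have hτ' := im_neg_one_div_pos hτ
  have hdiff {σ : ℂ} (hσ : 0 < σ.im) : Differentiable ℂ fun ν => Theta ν σ := by
    rw [← differentiableOn_univ]
    exact differentiableOn_Theta.comp (f := fun ν : ℂ => (ν, σ)) (by fun_prop) fun _ _ => hσ
  have hne {σ : ℂ} (hσ : 0 < σ.im) : ∃ ν, Theta ν σ ≠ 0 := by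
    refine ⟨(1 / 2 : ℝ), Theta_ne_zero hσ fun m n h => ?_⟩
    have h1 := congrArg Complex.im h
    have h2 := congrArg Complex.re h
    simp only [Complex.ofReal_im, Complex.add_im, Complex.mul_im, Complex.intCast_re,
      Complex.intCast_im, zero_mul, add_zero] at h1
    have hm : (m : ℝ) = 0 := by
      rcases mul_eq_zero.1 h1.symm with h | h
      · exact h
      · exact absurd h hσ.ne'
    simp [Int.cast_eq_zero.1 hm] at h2
    have : (2 * n : ℝ) = 1 := by linarith
    have : 2 * n = 1 := by exact_mod_cast this
    omega
  -- The factor `exp (-π i ν)` turns the sign under `ν ↦ ν + 1` into periodicity.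
  set T : ℂ → ℂ := fun ν => Complex.exp (-(Real.pi * Complex.I * ν)) * Theta ν τ with hT
  set f : ℂ → ℂ := fun ν => Complex.exp (-(Real.pi * Complex.I * ν)) *
    (Complex.exp (-(Real.pi * Complex.I * ν ^ 2 / τ)) * Theta (ν / τ) (-1 / τ)) with hf
  have hTd : Differentiable ℂ T := by
    have := hdiff hτ
    fun_prop
  have hfd : Differentiable ℂ f := by
    have : Differentiable ℂ fun ν : ℂ => Theta (ν / τ) (-1 / τ) :=
      (hdiff hτ').comp (differentiable_id.div_const τ)
    fun_prop
  have hexp (ν : ℂ) : Complex.exp (-(Real.pi * Complex.I * (ν + 1))) =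
      -Complex.exp (-(Real.pi * Complex.I * ν)) := by
    rw [← Complex.exp_sub_pi_mul_I]
    ring_nf
  have hT1 (ν : ℂ) : T (ν + 1) = T ν := by
    simp only [hT, Theta_add_one _ hτ, hexp]
    ring
  have hT2 (ν : ℂ) : T (ν + τ) = -Complex.exp (-(2 * Real.pi * Complex.I * (τ + ν))) * T ν := by
    simp only [hT, Theta_add_tau _ hτ]
    have : Complex.exp (-(Real.pi * Complex.I * (ν + τ))) *
        Complex.exp (-(Real.pi * Complex.I * (τ + 2 * ν))) =
        Complex.exp (-(2 * Real.pi * Complex.I * (τ + ν))) *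
        Complex.exp (-(Real.pi * Complex.I * ν)) := by
      rw [← Complex.exp_add, ← Complex.exp_add]
      ring_nf
    linear_combination (-Theta ν τ) * this
  have hf1 (ν : ℂ) : f (ν + 1) = f ν := by
    have h1 : Theta ((ν + 1) / τ) (-1 / τ) = -Complex.exp (Real.pi * Complex.I * (2 * ν + 1) / τ) *
        Theta (ν / τ) (-1 / τ) := by
      have := Theta_add_tau ((ν + 1) / τ) hτ'
      rw [show (ν + 1) / τ + -1 / τ = ν / τ by ring] at this
      rw [this, ← mul_assoc, neg_mul_neg, ← Complex.exp_add]
      rw [show Real.pi * Complex.I * (2 * ν + 1) / τ +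
        -(Real.pi * Complex.I * (-1 / τ + 2 * ((ν + 1) / τ))) = 0 by ring]
      simp
    simp only [hf, h1, hexp]
    have : Complex.exp (-(Real.pi * Complex.I * (ν + 1) ^ 2 / τ)) *
        Complex.exp (Real.pi * Complex.I * (2 * ν + 1) / τ) =
        Complex.exp (-(Real.pi * Complex.I * ν ^ 2 / τ)) := by
      rw [← Complex.exp_add]
      ring_nf
    linear_combination (Complex.exp (-(Real.pi * Complex.I * ν)) * Theta (ν / τ) (-1 / τ)) * this
  have hf2 (ν : ℂ) : f (ν + τ) = -Complex.exp (-(2 * Real.pi * Complex.I * (τ + ν))) * f ν := by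
    simp only [hf]
    rw [add_div, div_self hτ0, Theta_add_one _ hτ']
    have : Complex.exp (-(Real.pi * Complex.I * (ν + τ))) *
        Complex.exp (-(Real.pi * Complex.I * (ν + τ) ^ 2 / τ)) =
        Complex.exp (-(2 * Real.pi * Complex.I * (τ + ν))) *
        (Complex.exp (-(Real.pi * Complex.I * ν)) *
          Complex.exp (-(Real.pi * Complex.I * ν ^ 2 / τ))) := by
      rw [← Complex.exp_add, ← Complex.exp_add, ← Complex.exp_add]
      congr 1
      field_simp
      ring
    linear_combination (-Theta (ν / τ) (-1 / τ)) * this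
  have hT0 : lineCoeff T 0 0 ≠ 0 := by
    intro h
    obtain ⟨ν, hν⟩ := hne hτ
    have := congrFun (eq_zero_of_lineCoeff_eq_zero hTd hT1 hT2 h) ν
    simp [hT, hν] at this
  have hf0 : lineCoeff f 0 0 ≠ 0 := by
    intro h
    obtain ⟨ν, hν⟩ := hne hτ'
    have := congrFun (eq_zero_of_lineCoeff_eq_zero hfd hf1 hf2 h) (ν * τ)
    simp [hf, hν, hτ0] at this
  -- The combination of the two functions whose constant Fourier coefficient is zero.
  have hcomb := eq_zero_of_lineCoeff_eq_zero (τ := τ)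
    (g := fun ν => lineCoeff T 0 0 * f ν - lineCoeff f 0 0 * T ν) (by fun_prop)
    (fun ν => by simp only [hf1, hT1]) (fun ν => by simp only [hf2, hT2]; ring) (by
      have hi {g : ℂ → ℂ} (hg : Differentiable ℂ g) :
          IntervalIntegrable (fun x : ℝ => g x) MeasureTheory.volume 0 1 :=
        (hg.continuous.comp Complex.continuous_ofReal).intervalIntegrable _ _
      have hl (g : ℂ → ℂ) : lineCoeff g 0 0 = ∫ x in (0 : ℝ)..1, g x := by simp [lineCoeff]
      rw [hl, intervalIntegral.integral_sub ((hi hfd).const_mul _) ((hi hTd).const_mul _),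
        intervalIntegral.integral_const_mul, intervalIntegral.integral_const_mul, ← hl, ← hl]
      ring)
  refine ⟨lineCoeff f 0 0 / lineCoeff T 0 0, div_ne_zero hf0 hT0, fun ν => ?_⟩
  have h := congrFun hcomb ν
  simp only [hf, hT, Pi.zero_apply] at h
  have hexp0 := Complex.exp_ne_zero (-(Real.pi * Complex.I * ν))
  have h' : lineCoeff T 0 0 * (Complex.exp (-(Real.pi * Complex.I * ν ^ 2 / τ)) *
      Theta (ν / τ) (-1 / τ)) = lineCoeff f 0 0 * Theta ν τ := by
    apply mul_left_cancel₀ hexp0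
    linear_combination h
  rw [Complex.exp_neg] at h'
  have := Complex.exp_ne_zero (Real.pi * Complex.I * ν ^ 2 / τ)
  field_simp at h' ⊢
  linear_combination h'

/-! ### The factors of a summand of the elliptic genus -/

/-- The factor
`exp (-2 π i z u) Θ((1 - q) z - u τ - v, τ) / Θ(q z + u τ + v, τ)` of a summand of the elliptic
genus. -/
def thetaQuot (q u v z τ : ℂ) : ℂ :=
  Complex.exp (-(2 * Real.pi * Complex.I * z * u)) *
    (Theta ((1 - q) * z - u * τ - v) τ / Theta (q * z + u * τ + v) τ)

theorem thetaQuot_add_int (q u v z : ℂ) {τ : ℂ} (hτ : 0 < τ.im) (m n : ℤ) :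
    thetaQuot q (u + m) (v + n) z τ = thetaQuot q u v z τ := by
  have h1 := Theta_add_lattice ((1 - q) * z - u * τ - v) hτ (-m) (-n)
  have h2 := Theta_add_lattice (q * z + u * τ + v) hτ m n
  push_cast at h1
  rw [thetaQuot, thetaQuot,
    show (1 - q) * z - (u + m) * τ - (v + n) = (1 - q) * z - u * τ - v + -m * τ + -n by ring, h1,
    show q * z + (u + m) * τ + (v + n) = q * z + u * τ + v + m * τ + n by ring, h2,
    mul_div_mul_comm, ← mul_assoc, thetaFactor, thetaFactor, ← Complex.exp_sub, ← Complex.exp_add]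
  congr 1
  rw [Complex.exp_eq_exp_iff_exists_int]
  exact ⟨-n - m, by push_cast; ring⟩

theorem thetaQuot_z_add_one (q u v z : ℂ) {τ : ℂ} (hτ : 0 < τ.im) :
    thetaQuot q u v (z + 1) τ =
      -Complex.exp (-(2 * Real.pi * Complex.I * u)) * thetaQuot q u (v + q) z τ := by
  rw [thetaQuot, thetaQuot,
    show (1 - q) * (z + 1) - u * τ - v = (1 - q) * z - u * τ - (v + q) + 1 by ring,
    Theta_add_one _ hτ, show q * (z + 1) + u * τ + v = q * z + u * τ + (v + q) by ring,
    show -(2 * Real.pi * Complex.I * (z + 1) * u) =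
      -(2 * Real.pi * Complex.I * u) + -(2 * Real.pi * Complex.I * z * u) by ring, Complex.exp_add]
  ring

theorem thetaQuot_z_add_tau (q u v z : ℂ) {τ : ℂ} (hτ : 0 < τ.im) :
    thetaQuot q u v (z + τ) τ =
      -Complex.exp (-(Complex.I * Real.pi * ((1 - 2 * q) * (τ + 2 * z)))) *
        Complex.exp (2 * Real.pi * Complex.I * v) * thetaQuot q (u + q) v z τ := by
  rw [thetaQuot, thetaQuot,
    show (1 - q) * (z + τ) - u * τ - v = (1 - q) * z - (u + q) * τ - v + τ by ring,
    Theta_add_tau _ hτ, show q * (z + τ) + u * τ + v = q * z + (u + q) * τ + v by ring]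
  have : Complex.exp (-(2 * Real.pi * Complex.I * (z + τ) * u)) *
      Complex.exp (-(Real.pi * Complex.I * (τ + 2 * ((1 - q) * z - (u + q) * τ - v)))) =
      Complex.exp (-(Complex.I * Real.pi * ((1 - 2 * q) * (τ + 2 * z)))) *
        Complex.exp (2 * Real.pi * Complex.I * v) *
        Complex.exp (-(2 * Real.pi * Complex.I * z * (u + q))) := by
    rw [← Complex.exp_add, ← Complex.exp_add, ← Complex.exp_add]
    ring_nf
  linear_combination (-(Theta ((1 - q) * z - (u + q) * τ - v) τ /
    Theta (q * z + (u + q) * τ + v) τ)) * this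

theorem thetaQuot_tau_add_one (q u v z : ℂ) {τ : ℂ} (hτ : 0 < τ.im) :
    thetaQuot q u v z (τ + 1) = thetaQuot q u (v + u) z τ := by
  rw [thetaQuot, thetaQuot, Theta_tau_add_one _ hτ, Theta_tau_add_one _ hτ,
    mul_div_mul_left _ _ (Complex.exp_ne_zero _)]
  ring_nf

theorem thetaQuot_inversion (q u v z : ℂ) {τ : ℂ} (hτ : 0 < τ.im) :
    thetaQuot q u v (z / τ) (-1 / τ) =
      Complex.exp (Complex.I * Real.pi * (1 - 2 * q) * z ^ 2 / τ) * thetaQuot q v (-u) z τ := by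
  have hτ0 : τ ≠ 0 := by
    rintro rfl
    simp at hτ
  obtain ⟨C, hC, h⟩ := exists_Theta_inversion hτ
  rw [thetaQuot, thetaQuot,
    show (1 - q) * (z / τ) - u * (-1 / τ) - v = ((1 - q) * z - v * τ - -u) / τ by field_simp; ring,
    show q * (z / τ) + u * (-1 / τ) + v = (q * z + v * τ + -u) / τ by field_simp; ring, h, h,
    mul_div_mul_comm, mul_div_mul_left _ _ hC, ← Complex.exp_sub, ← mul_assoc, ← mul_assoc,
    ← Complex.exp_add, ← Complex.exp_add]
  congr 2
  field_simp
  ring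

theorem eq_of_mul_add_eq {τ : ℂ} (hτ : 0 < τ.im) {r s r' s' : ℝ}
    (h : (r * τ + s : ℂ) = r' * τ + s') : r = r' ∧ s = s' := by
  have h1 := congrArg Complex.im h
  have h2 := congrArg Complex.re h
  simp only [Complex.add_im, Complex.mul_im, Complex.ofReal_re, Complex.ofReal_im, zero_mul,
    add_zero] at h1
  have hr : r = r' := mul_right_cancel₀ hτ.ne' h1
  subst hr
  simpa using h2

open Classical in
/-- The order of vanishing of `Θ(α w + r τ + s, τ)` along the curve `w = z - a τ - b = 0`, for real
`r` and `s`: one if `r` and `s` are integers, and zero otherwise. -/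
theorem exists_Theta_eq_mul (α : ℂ) (a b r s : ℝ) {τ₀ : ℂ} (hτ : 0 < τ₀.im) :
    ∃ h : ℂ × ℂ → ℂ, h (a * τ₀ + b, τ₀) ≠ 0 ∧
      DifferentiableOn ℂ h {p | 0 < p.2.im} ∧ ∀ p ∈ {p : ℂ × ℂ | 0 < p.2.im},
        Theta (α * (p.1 - a * p.2 - b) + r * p.2 + s) p.2 =
          (if ∃ m n : ℤ, r = m ∧ s = n then α * (p.1 - a * p.2 - b) else 1) * h p := by
  by_cases hrs : ∃ m n : ℤ, r = m ∧ s = n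
  · simp only [hrs, if_true]
    obtain ⟨m, n, rfl, rfl⟩ := hrs
    refine ⟨fun p => thetaFactor m n (α * (p.1 - a * p.2 - b)) p.2 *
      thetaDiv (α * (p.1 - a * p.2 - b)) p.2, ?_, ?_, fun p hp => ?_⟩
    · dsimp only
      rw [show α * (a * τ₀ + b - a * τ₀ - b) = 0 by ring]
      exact mul_ne_zero (Complex.exp_ne_zero _) (thetaDiv_zero_ne_zero hτ)
    · refine DifferentiableOn.mul (by unfold thetaFactor; fun_prop) ?_
      exact differentiableOn_thetaDiv.comp
        (f := fun p : ℂ × ℂ => (α * (p.1 - a * p.2 - b), p.2)) (by fun_prop) fun p hp => hp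
    · rw [Complex.ofReal_intCast, Complex.ofReal_intCast, Theta_add_lattice _ hp,
        Theta_eq_mul_thetaDiv _ hp]
      ring
  · simp only [hrs, if_false, one_mul]
    refine ⟨fun p => Theta (α * (p.1 - a * p.2 - b) + r * p.2 + s) p.2, ?_, ?_, fun p hp => rfl⟩
    · refine Theta_ne_zero hτ fun m n h => hrs ?_
      have h' : (r * τ₀ + s : ℂ) = (m : ℝ) * τ₀ + (n : ℝ) := by
        push_cast
        linear_combination h
      exact ⟨m, n, eq_of_mul_add_eq hτ h'⟩
    · exact differentiableOn_Theta.comp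
        (f := fun p : ℂ × ℂ => (α * (p.1 - a * p.2 - b) + r * p.2 + s, p.2)) (by fun_prop)
        fun p hp => hp

open Classical in
/-- Near a point of the curve `z = a τ + b` a product of factors `thetaQuot` is holomorphic,
provided that at least as many of the numerators as of the denominators vanish along the curve.
Off the curve no denominator vanishes. -/
theorem exists_local_extension {d : ℕ} (q : Fin d → ℚ) (hq : ∀ j, q j ≠ 0) (u v : Fin d → ℝ)
    (a b : ℝ) {τ₀ : ℂ} (hτ : 0 < τ₀.im) :
    ∃ g : ℂ × ℂ → ℂ, ∀ᶠ p in 𝓝 ((a * τ₀ + b, τ₀) : ℂ × ℂ), DifferentiableAt ℂ g p ∧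
      ((Finset.univ.filter fun j => ∃ m n : ℤ, q j * a + u j = m ∧ q j * b + v j = n).card ≤
        (Finset.univ.filter fun j => ∃ m n : ℤ,
          a - (q j * a + u j) = m ∧ b - (q j * b + v j) = n).card →
        (∀ j, Theta (q j * p.1 + u j * p.2 + v j) p.2 ≠ 0) →
        ∏ j, thetaQuot (q j) (u j) (v j) p.1 p.2 = g p) ∧
      (p.1 ≠ a * p.2 + b → ∀ j, Theta (q j * p.1 + u j * p.2 + v j) p.2 ≠ 0) := by
  set S := Finset.univ.filter fun j => ∃ m n : ℤ, q j * a + u j = m ∧ q j * b + v j = n with hS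
  set T := Finset.univ.filter fun j => ∃ m n : ℤ,
    a - (q j * a + u j) = m ∧ b - (q j * b + v j) = n with hT
  have hU : IsOpen {p : ℂ × ℂ | 0 < p.2.im} :=
    isOpen_lt continuous_const (Complex.continuous_im.comp continuous_snd)
  choose D hD0 hDd hD using fun j =>
    exists_Theta_eq_mul (q j) a b (q j * a + u j) (q j * b + v j) hτ
  choose N hN0 hNd hN using fun j =>
    exists_Theta_eq_mul (1 - q j) a b (a - (q j * a + u j)) (b - (q j * b + v j)) hτ
  -- The equation of the curve. The factors of theta functions in `S` and `T` vanish there to first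
  -- order, the others not at all.
  let w : ℂ × ℂ → ℂ := fun p => p.1 - a * p.2 - b
  have hD' (j) (p : ℂ × ℂ) (hp : 0 < p.2.im) :
      Theta (q j * p.1 + u j * p.2 + v j) p.2 = (if j ∈ S then q j * w p else 1) * D j p := by
    rw [show (q j * p.1 + u j * p.2 + v j : ℂ) = q j * (p.1 - a * p.2 - b) +
      ((q j * a + u j : ℝ) : ℂ) * p.2 + ((q j * b + v j : ℝ) : ℂ) by push_cast; ring, hD j p hp]
    simp [hS, w]
  have hN' (j) (p : ℂ × ℂ) (hp : 0 < p.2.im) :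
      Theta ((1 - q j) * p.1 - u j * p.2 - v j) p.2 =
        (if j ∈ T then (1 - q j) * w p else 1) * N j p := by
    rw [show ((1 - q j) * p.1 - u j * p.2 - v j : ℂ) = (1 - q j) * (p.1 - a * p.2 - b) +
      ((a - (q j * a + u j) : ℝ) : ℂ) * p.2 + ((b - (q j * b + v j) : ℝ) : ℂ) by
        push_cast; ring, hN j p hp]
    simp [hT, w]
  let h : Fin d → ℂ × ℂ → ℂ := fun j p =>
    Complex.exp (-(2 * Real.pi * Complex.I * p.1 * u j)) * (N j p / D j p)
  -- The subtraction is genuine where the function is used, since there `S.card ≤ T.card`.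
  refine ⟨fun p => w p ^ (T.card - S.card) * ((∏ j ∈ T, (1 - (q j : ℂ))) / ∏ j ∈ S, (q j : ℂ)) *
    ∏ j, h j p, ?_⟩
  have hev : ∀ᶠ p in 𝓝 ((a * τ₀ + b, τ₀) : ℂ × ℂ), ∀ j, D j p ≠ 0 :=
    Filter.eventually_all.2 fun j =>
      ((hDd j).differentiableAt (hU.mem_nhds hτ)).continuousAt.eventually_ne (hD0 j)
  filter_upwards [hev, hU.mem_nhds (x := ((a * τ₀ + b, τ₀) : ℂ × ℂ)) hτ] with p hpD hp
  refine ⟨?_, fun hcard hden => ?_, fun hw j => ?_⟩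
  · have hh (j) : DifferentiableAt ℂ (h j) p := by
      have h1 := (hNd j).differentiableAt (hU.mem_nhds hp)
      have h2 := (hDd j).differentiableAt (hU.mem_nhds hp)
      have h3 : DifferentiableAt ℂ (fun p => N j p / D j p) p := by
        simp only [div_eq_mul_inv]
        exact h1.mul (h2.inv (hpD j))
      exact DifferentiableAt.mul (by fun_prop) h3
    have hprod : DifferentiableAt ℂ (fun p => ∏ j, h j p) p :=
      (HasFDerivAt.finsetProd fun j _ => (hh j).hasFDerivAt).differentiableAt
    exact DifferentiableAt.mul (by fun_prop) hprod
  · have hwS : w p ^ S.card ≠ 0 := by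
      rcases S.eq_empty_or_nonempty with h0 | ⟨j, hj⟩
      · simp [h0]
      · refine pow_ne_zero _ fun h0 => hden j ?_
        rw [hD' j p hp, if_pos hj, h0, mul_zero, zero_mul]
    have hqS : ∏ j ∈ S, (q j : ℂ) ≠ 0 :=
      Finset.prod_ne_zero_iff.2 fun j _ => Rat.cast_ne_zero.2 (hq j)
    have e1 : ∏ j, (if j ∈ S then (q j : ℂ) * w p else 1) =
        (∏ j ∈ S, (q j : ℂ)) * w p ^ S.card := by
      rw [Finset.prod_ite_mem, Finset.univ_inter, Finset.prod_mul_distrib, Finset.prod_const]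
    have e2 : ∏ j, (if j ∈ T then (1 - (q j : ℂ)) * w p else 1) =
        (∏ j ∈ T, (1 - (q j : ℂ))) * w p ^ T.card := by
      rw [Finset.prod_ite_mem, Finset.univ_inter, Finset.prod_mul_distrib, Finset.prod_const]
    have e3 (j) : thetaQuot (q j) (u j) (v j) p.1 p.2 =
        (if j ∈ T then (1 - (q j : ℂ)) * w p else 1) / (if j ∈ S then (q j : ℂ) * w p else 1) *
          h j p := by
      rw [thetaQuot, hD' j p hp, hN' j p hp, mul_div_mul_comm]
      ring
    simp only [e3]
    rw [Finset.prod_mul_distrib, Finset.prod_div_distrib, e1, e2, ← pow_sub_mul_pow (w p) hcard]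
    field_simp
  · rw [hD' j p hp]
    refine mul_ne_zero ?_ (hpD j)
    split_ifs
    · refine mul_ne_zero (Rat.cast_ne_zero.2 (hq j)) fun h0 => hw ?_
      linear_combination h0
    · exact one_ne_zero

/-! ### The summands of the elliptic genus -/

variable {d : ℕ}

theorem norm_eq_one_of_mem_Aut {W : Potential d} {γ : Fin d → ℂˣ} (h : γ ∈ W.Aut) (j : Fin d) :
    ‖(γ j : ℂ)‖ = 1 := by
  have : Finite W.Aut := Set.finite_coe_iff.2 W.finite_Aut
  obtain ⟨k, hk, hk'⟩ := (isOfFinOrder_of_finite (⟨γ, h⟩ : W.Aut)).exists_pow_eq_one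
  have h1 : (γ j : ℂ) ^ k = 1 := by
    have := congrFun (congrArg Subtype.val hk') j
    simpa using congrArg Units.val this
  exact Complex.norm_eq_one_of_pow_eq_one h1 hk.ne'

theorem exp_theta_of_mem_Aut {W : Potential d} {γ : Fin d → ℂˣ} (h : γ ∈ W.Aut) (j : Fin d) :
    Complex.exp (2 * Real.pi * Complex.I * (theta j γ : ℂ)) = (γ j : ℂ) :=
  exp_theta j γ (norm_eq_one_of_mem_Aut h j)

/-- The summand of the elliptic genus for the pair `(γ, δ)` of diagonal automorphisms. -/
def ellTerm (W : Potential d) (γ δ : Fin d → ℂˣ) (z τ : ℂ) : ℂ :=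
  ∏ j, thetaQuot (W.q j) (theta j γ) (theta j δ) z τ

theorem ellQuotient_eq (W : Potential d) (G : Subgroup (Fin d → ℂˣ)) [Fintype G] (p : ℂ × ℂ) :
    ellQuotient W G p =
      (1 / (Nat.card G : ℂ)) * ∑ γ : G, ∑ δ : G, ellTerm W γ δ p.1 p.2 := by
  simp only [ellQuotient, finsum_eq_sum_of_fintype]
  rfl

theorem exists_int_of_exp_eq {u u' : ℂ} (h : Complex.exp (2 * Real.pi * Complex.I * u) =
    Complex.exp (2 * Real.pi * Complex.I * u')) : ∃ m : ℤ, u = u' + m := by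
  obtain ⟨m, hm⟩ := Complex.exp_eq_exp_iff_exists_int.1 h
  refine ⟨m, mul_left_cancel₀ Complex.two_pi_I_ne_zero ?_⟩
  linear_combination hm

/-- In a summand the arguments in `[0, 1)` can be replaced by any logarithms of the coordinates. -/
theorem ellTerm_eq {W : Potential d} {γ δ : Fin d → ℂˣ} (hγ : γ ∈ W.Aut) (hδ : δ ∈ W.Aut)
    {u v : Fin d → ℂ} (hu : ∀ j, Complex.exp (2 * Real.pi * Complex.I * u j) = γ j)
    (hv : ∀ j, Complex.exp (2 * Real.pi * Complex.I * v j) = δ j) (z : ℂ) {τ : ℂ}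
    (hτ : 0 < τ.im) : ∏ j, thetaQuot (W.q j) (u j) (v j) z τ = ellTerm W γ δ z τ := by
  refine Finset.prod_congr rfl fun j _ => ?_
  obtain ⟨m, hm⟩ := exists_int_of_exp_eq ((hu j).trans (exp_theta_of_mem_Aut hγ j).symm)
  obtain ⟨n, hn⟩ := exists_int_of_exp_eq ((hv j).trans (exp_theta_of_mem_Aut hδ j).symm)
  rw [hm, hn, thetaQuot_add_int _ _ _ _ hτ]

theorem Potential.sum_one_sub_two_mul (W : Potential d) :
    ∑ j, (1 - 2 * (W.q j : ℂ)) = (W.cHat : ℂ) := by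
  simp [Potential.cHat, Finset.mul_sum]

theorem prod_exp_theta {W : Potential d} {γ : Fin d → ℂˣ} (h : γ ∈ W.SL) :
    ∏ j, Complex.exp (2 * Real.pi * Complex.I * (theta j γ : ℂ)) = 1 := by
  simp only [exp_theta_of_mem_Aut h.1]
  have := congrArg Units.val h.2
  simpa using this

theorem ellTerm_z_add_one {W : Potential d} {γ δ : Fin d → ℂˣ} (hJ : W.J ∈ W.SL) (hγ : γ ∈ W.SL)
    (hδ : δ ∈ W.SL) (z : ℂ) {τ : ℂ} (hτ : 0 < τ.im) :
    ellTerm W γ δ (z + 1) τ = (-1) ^ d * ellTerm W γ (δ * W.J) z τ := by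
  rw [← ellTerm_eq hγ.1 (W.SL.mul_mem hδ hJ).1 (exp_theta_of_mem_Aut hγ.1)
    (v := fun j => theta j δ + W.q j) (fun j => ?_) z hτ]
  · have h := prod_exp_theta (W.SL.inv_mem hγ)
    have h1 (j : Fin d) : Complex.exp (-(2 * Real.pi * Complex.I * (theta j γ : ℂ))) =
        Complex.exp (2 * Real.pi * Complex.I * (theta j γ⁻¹ : ℂ)) := by
      rw [Complex.exp_neg, exp_theta_of_mem_Aut hγ.1, exp_theta_of_mem_Aut (W.SL.inv_mem hγ).1]
      simp
    simp only [ellTerm, thetaQuot_z_add_one _ _ _ _ hτ, h1]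
    rw [Finset.prod_mul_distrib, Finset.prod_neg, h]
    simp
  · rw [mul_add, Complex.exp_add, exp_theta_of_mem_Aut hδ.1]
    simp [Potential.J]

theorem ellTerm_z_add_tau {W : Potential d} {γ δ : Fin d → ℂˣ} (hJ : W.J ∈ W.SL) (hγ : γ ∈ W.SL)
    (hδ : δ ∈ W.SL) (z : ℂ) {τ : ℂ} (hτ : 0 < τ.im) :
    ellTerm W γ δ (z + τ) τ = (-1) ^ d *
      Complex.exp (-(Complex.I * Real.pi * W.cHat * (τ + 2 * z))) * ellTerm W (γ * W.J) δ z τ := by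
  rw [← ellTerm_eq (W.SL.mul_mem hγ hJ).1 hδ.1 (u := fun j => theta j γ + W.q j) (fun j => ?_)
    (exp_theta_of_mem_Aut hδ.1) z hτ]
  · simp only [ellTerm, thetaQuot_z_add_tau _ _ _ _ hτ]
    rw [Finset.prod_mul_distrib, Finset.prod_mul_distrib, prod_exp_theta hδ, mul_one,
      Finset.prod_neg, ← Complex.exp_sum, Finset.sum_neg_distrib, ← Finset.mul_sum,
      ← Finset.sum_mul, W.sum_one_sub_two_mul]
    simp [mul_assoc]
  · rw [mul_add, Complex.exp_add, exp_theta_of_mem_Aut hγ.1]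
    simp [Potential.J]

theorem ellTerm_tau_add_one {W : Potential d} {γ δ : Fin d → ℂˣ} (hγ : γ ∈ W.SL)
    (hδ : δ ∈ W.SL) (z : ℂ) {τ : ℂ} (hτ : 0 < τ.im) :
    ellTerm W γ δ z (τ + 1) = ellTerm W γ (δ * γ) z τ := by
  rw [← ellTerm_eq hγ.1 (W.SL.mul_mem hδ hγ).1 (exp_theta_of_mem_Aut hγ.1)
    (v := fun j => theta j δ + theta j γ) (fun j => ?_) z hτ]
  · simp only [ellTerm, thetaQuot_tau_add_one _ _ _ _ hτ]
  · rw [mul_add, Complex.exp_add, exp_theta_of_mem_Aut hδ.1, exp_theta_of_mem_Aut hγ.1]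
    simp

theorem ellTerm_inversion {W : Potential d} {γ δ : Fin d → ℂˣ} (hγ : γ ∈ W.SL)
    (hδ : δ ∈ W.SL) (z : ℂ) {τ : ℂ} (hτ : 0 < τ.im) :
    ellTerm W γ δ (z / τ) (-1 / τ) =
      Complex.exp (Complex.I * Real.pi * W.cHat * z ^ 2 / τ) * ellTerm W δ γ⁻¹ z τ := by
  rw [← ellTerm_eq hδ.1 (W.SL.inv_mem hγ).1 (exp_theta_of_mem_Aut hδ.1)
    (v := fun j => -theta j γ) (fun j => ?_) z hτ]
  · simp only [ellTerm, thetaQuot_inversion _ _ _ _ hτ]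
    rw [Finset.prod_mul_distrib, ← Complex.exp_sum, ← Finset.sum_div, ← Finset.sum_mul,
      ← Finset.mul_sum, W.sum_one_sub_two_mul]
  · rw [mul_neg, Complex.exp_neg, exp_theta_of_mem_Aut hγ.1]
    simp

/-! ### Transformation laws of the sum over the group -/

theorem finite_of_le_SL {W : Potential d} {G : Subgroup (Fin d → ℂˣ)} (hSL : G ≤ W.SL) : Finite G :=
  Set.finite_coe_iff.2 (W.finite_Aut.subset fun _ h => (hSL h).1)

section

variable {W : Potential d} {G : Subgroup (Fin d → ℂˣ)} (hSL : G ≤ W.SL)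
include hSL

theorem ellQuotient_z_add_one (hJ : W.J ∈ G) (z : ℂ) {τ : ℂ} (hτ : 0 < τ.im) :
    ellQuotient W G (z + 1, τ) = (-1) ^ d * ellQuotient W G (z, τ) := by
  have := finite_of_le_SL hSL
  have := Fintype.ofFinite G
  simp only [ellQuotient_eq, ellTerm_z_add_one (hSL hJ) (hSL (Subtype.prop _))
    (hSL (Subtype.prop _)) z hτ, ← Finset.mul_sum]
  have h (γ : G) := Equiv.sum_comp (Equiv.mulRight (⟨W.J, hJ⟩ : G)) fun δ : G => ellTerm W γ δ z τ
  simp only [Equiv.coe_mulRight, Subgroup.coe_mul] at h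
  simp only [h]
  ring

theorem ellQuotient_z_add_tau (hJ : W.J ∈ G) (z : ℂ) {τ : ℂ} (hτ : 0 < τ.im) :
    ellQuotient W G (z + τ, τ) = (-1) ^ d *
      Complex.exp (-(Complex.I * Real.pi * W.cHat * (τ + 2 * z))) * ellQuotient W G (z, τ) := by
  have := finite_of_le_SL hSL
  have := Fintype.ofFinite G
  simp only [ellQuotient_eq, ellTerm_z_add_tau (hSL hJ) (hSL (Subtype.prop _))
    (hSL (Subtype.prop _)) z hτ, ← Finset.mul_sum]
  have h := Equiv.sum_comp (Equiv.mulRight (⟨W.J, hJ⟩ : G)) fun γ : G => ∑ δ : G, ellTerm W γ δ z τ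
  simp only [Equiv.coe_mulRight, Subgroup.coe_mul] at h
  rw [h]
  ring

theorem ellQuotient_tau_add_one (z : ℂ) {τ : ℂ} (hτ : 0 < τ.im) :
    ellQuotient W G (z, τ + 1) = ellQuotient W G (z, τ) := by
  have := finite_of_le_SL hSL
  have := Fintype.ofFinite G
  simp only [ellQuotient_eq, ellTerm_tau_add_one (hSL (Subtype.prop _))
    (hSL (Subtype.prop _)) z hτ]
  have h (γ : G) := Equiv.sum_comp (Equiv.mulRight γ) fun δ : G => ellTerm W γ δ z τ
  simp only [Equiv.coe_mulRight, Subgroup.coe_mul] at h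
  simp only [h]

theorem ellQuotient_inversion (z : ℂ) {τ : ℂ} (hτ : 0 < τ.im) :
    ellQuotient W G (z / τ, -1 / τ) =
      Complex.exp (Complex.I * Real.pi * W.cHat * z ^ 2 / τ) * ellQuotient W G (z, τ) := by
  have := finite_of_le_SL hSL
  have := Fintype.ofFinite G
  simp only [ellQuotient_eq, ellTerm_inversion (hSL (Subtype.prop _))
    (hSL (Subtype.prop _)) z hτ, ← Finset.mul_sum]
  rw [Finset.sum_comm]
  have h (δ : G) := Equiv.sum_comp (Equiv.inv G) fun γ : G => ellTerm W δ γ z τ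
  simp only [Equiv.inv_apply, Subgroup.coe_inv] at h
  simp only [h]
  ring

end

/-! ### Holomorphy of the elliptic genus -/

theorem exists_int_iff_addCircle (x : ℝ) : (∃ m : ℤ, x = m) ↔ (x : AddCircle (1 : ℝ)) = 0 := by
  rw [AddCircle.coe_eq_zero_iff]
  simp [eq_comm]

open Classical in
/-- Along the curve `z = a τ + b` at least as many numerators as denominators of a summand vanish:
apply `Potential.card_eq_zero_le_card_eq` to the torus elements with logarithms `q a + θ(γ)` and
`q b + θ(δ)`, which multiply every monomial by `exp (2 π i a)` and `exp (2 π i b)`. -/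
theorem card_poles_le_card_zeros {W : Potential d} (hlin : ∀ i k, W.A i ≠ Pi.single k 1)
    {γ δ : Fin d → ℂˣ} (hγ : γ ∈ W.Aut) (hδ : δ ∈ W.Aut) (a b : ℝ) :
    (Finset.univ.filter fun j => ∃ m n : ℤ,
        W.q j * a + theta j γ = m ∧ W.q j * b + theta j δ = n).card ≤
      (Finset.univ.filter fun j => ∃ m n : ℤ,
        a - (W.q j * a + theta j γ) = m ∧ b - (W.q j * b + theta j δ) = n).card := by
  have key {γ : Fin d → ℂˣ} (hγ : γ ∈ W.Aut) (a : ℝ) (i : Fin d) :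
      ∑ j, W.A i j • ((W.q j * a + theta j γ : ℝ) : AddCircle (1 : ℝ)) =
        (a : AddCircle (1 : ℝ)) := by
    have h1 : ∑ j, (W.A i j : ℝ) * (W.q j * a + theta j γ) = a + ∑ j, W.A i j * theta j γ := by
      have := congrArg (Rat.cast (K := ℝ)) (W.homogeneous i)
      push_cast at this
      simp only [mul_add, Finset.sum_add_distrib, ← mul_assoc, ← Finset.sum_mul, this, one_mul]
    obtain ⟨m, hm⟩ : ∃ m : ℤ, (∑ j, W.A i j * theta j γ : ℝ) = m := by
      have h2 : Complex.exp (2 * Real.pi * Complex.I * (∑ j, W.A i j * theta j γ : ℝ)) =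
          Complex.exp (2 * Real.pi * Complex.I * 0) := by
        push_cast
        rw [Finset.mul_sum, Complex.exp_sum, mul_zero, Complex.exp_zero]
        have := congrArg Units.val (hγ i)
        push_cast at this
        rw [← this]
        refine Finset.prod_congr rfl fun j _ => ?_
        rw [← exp_theta_of_mem_Aut hγ j, ← Complex.exp_nat_mul]
        ring_nf
      obtain ⟨m, hm⟩ := exists_int_of_exp_eq h2
      exact ⟨m, by rw [zero_add] at hm; exact_mod_cast hm⟩
    have h3 : ((∑ j, (W.A i j : ℝ) * (W.q j * a + theta j γ) : ℝ) : AddCircle (1 : ℝ)) = a := by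
      rw [h1, hm, AddCircle.coe_add, (exists_int_iff_addCircle _).1 ⟨m, rfl⟩, add_zero]
    rw [← h3]
    simp only [← nsmul_eq_mul]
    simp
  have h := W.card_eq_zero_le_card_eq hlin
    (fun j => (((W.q j * a + theta j γ : ℝ) : AddCircle (1 : ℝ)),
      ((W.q j * b + theta j δ : ℝ) : AddCircle (1 : ℝ))))
    ((a : AddCircle (1 : ℝ)), (b : AddCircle (1 : ℝ))) (fun i => by
      refine Prod.ext ?_ ?_
      · rw [Prod.fst_sum]
        exact key hγ a i
      · rw [Prod.snd_sum]
        exact key hδ b i)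
  convert h using 3 with j j
  · rw [Prod.mk_eq_zero, ← exists_int_iff_addCircle, ← exists_int_iff_addCircle]
    exact exists_and_exists_comm.symm
  · rw [Prod.mk.injEq, eq_comm (b := (a : AddCircle (1 : ℝ))),
      eq_comm (b := (b : AddCircle (1 : ℝ))),
      ← sub_eq_zero, ← sub_eq_zero (a := (b : AddCircle (1 : ℝ))), ← AddCircle.coe_sub,
      ← AddCircle.coe_sub, ← exists_int_iff_addCircle, ← exists_int_iff_addCircle]
    exact exists_and_exists_comm.symm

/-- If `W` contains a variable `x_k` as a monomial, every summand vanishes: `q_k = 1`, and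
automorphisms fix `x_k`. -/
theorem ellTerm_eq_zero_of_linear {W : Potential d} {i k : Fin d} (h : W.A i = Pi.single k 1)
    {γ δ : Fin d → ℂˣ} (hγ : γ ∈ W.Aut) (hδ : δ ∈ W.Aut) (z : ℂ) {τ : ℂ} (hτ : 0 < τ.im) :
    ellTerm W γ δ z τ = 0 := by
  have hq : W.q k = 1 := by
    have := W.homogeneous i
    rw [h, Finset.sum_eq_single k (fun j _ hj => by simp [hj]) (by simp)] at this
    simpa using this
  have hθ {γ : Fin d → ℂˣ} (hγ : γ ∈ W.Aut) : theta k γ = 0 := by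
    have := hγ i
    rw [h, Finset.prod_eq_single k (fun j _ hj => by simp [hj]) (by simp)] at this
    simp only [Pi.single_eq_same, pow_one] at this
    simp [theta, this]
  refine Finset.prod_eq_zero (Finset.mem_univ k) ?_
  simp [thetaQuot, hq, hθ hγ, hθ hδ, Theta_zero hτ]

variable {W : Potential d} {G : Subgroup (Fin d → ℂˣ)}

open Classical in
theorem exists_ellTerm_local_extension {γ δ : Fin d → ℂˣ} (hγ : γ ∈ W.Aut) (hδ : δ ∈ W.Aut)
    (a b : ℝ) {τ₀ : ℂ} (hτ : 0 < τ₀.im) :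
    ∃ g : ℂ × ℂ → ℂ, ∀ᶠ p in 𝓝 ((a * τ₀ + b, τ₀) : ℂ × ℂ), DifferentiableAt ℂ g p ∧
      ((∀ j, Theta (W.q j * p.1 + theta j γ * p.2 + theta j δ) p.2 ≠ 0) →
        ellTerm W γ δ p.1 p.2 = g p) ∧
      (p.1 ≠ a * p.2 + b →
        ∀ j, Theta (W.q j * p.1 + theta j γ * p.2 + theta j δ) p.2 ≠ 0) := by
  obtain ⟨g, hg⟩ := exists_local_extension W.q (fun j => (W.q_pos j).ne') (fun j => theta j γ)
    (fun j => theta j δ) a b hτ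
  by_cases hlin : ∀ i k, W.A i ≠ Pi.single k 1
  · refine ⟨g, hg.mono fun p hp => ⟨hp.1, hp.2.1 ?_, hp.2.2⟩⟩
    exact card_poles_le_card_zeros hlin hγ hδ a b
  · push Not at hlin
    obtain ⟨i, k, hik⟩ := hlin
    have hU : ∀ᶠ p in 𝓝 ((a * τ₀ + b, τ₀) : ℂ × ℂ), 0 < p.2.im :=
      (isOpen_lt continuous_const (Complex.continuous_im.comp continuous_snd)).mem_nhds hτ
    refine ⟨0, (hg.and hU).mono fun p hp => ⟨by fun_prop, fun _ => ?_, hp.1.2.2⟩⟩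
    exact ellTerm_eq_zero_of_linear hik hγ hδ _ hp.2

/-- Near every point with `Im τ > 0`, the quotient of theta functions coincides with a holomorphic
function where it is defined, and it is defined off a curve `z = a τ + b`. -/
theorem exists_ellQuotient_local_extension (hSL : G ≤ W.SL) {p₀ : ℂ × ℂ} (hp₀ : 0 < p₀.2.im) :
    ∃ (g : ℂ × ℂ → ℂ) (a b : ℝ), p₀.1 = a * p₀.2 + b ∧ ∀ᶠ p in 𝓝 p₀, DifferentiableAt ℂ g p ∧
      (p ∈ regularLocus W G → ellQuotient W G p = g p) ∧
      (p.1 ≠ a * p.2 + b → p ∈ regularLocus W G) := by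
  have := finite_of_le_SL hSL
  have := Fintype.ofFinite G
  obtain ⟨z₀, τ₀⟩ := p₀
  dsimp only at hp₀
  obtain ⟨a, b, rfl⟩ : ∃ a b : ℝ, z₀ = a * τ₀ + b := by
    refine ⟨z₀.im / τ₀.im, z₀.re - z₀.im / τ₀.im * τ₀.re, Complex.ext ?_ ?_⟩
    · simp
    · simp [hp₀.ne']
  choose g hg using fun c : G × G =>
    exists_ellTerm_local_extension (hSL c.1.2).1 (hSL c.2.2).1 a b hp₀
  have hU : ∀ᶠ p in 𝓝 ((a * τ₀ + b, τ₀) : ℂ × ℂ), 0 < p.2.im :=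
    (isOpen_lt continuous_const (Complex.continuous_im.comp continuous_snd)).mem_nhds hp₀
  refine ⟨fun p => (1 / (Nat.card G : ℂ)) * ∑ γ : G, ∑ δ : G, g (γ, δ) p, a, b, rfl, ?_⟩
  filter_upwards [Filter.eventually_all.2 hg, hU] with p hp hpU
  refine ⟨?_, fun hreg => ?_, fun hne => ⟨hpU, fun γ hγ δ hδ j =>
    (hp (⟨γ, hγ⟩, ⟨δ, hδ⟩)).2.2 hne j⟩⟩
  · exact (DifferentiableAt.fun_sum fun γ _ => DifferentiableAt.fun_sum fun δ _ =>
      (hp (γ, δ)).1).const_mul _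
  · rw [ellQuotient_eq]
    congr 1
    refine Finset.sum_congr rfl fun γ _ => Finset.sum_congr rfl fun δ _ => ?_
    exact (hp (γ, δ)).2.1 fun j => hreg.2 γ γ.2 δ δ.2 j

theorem subset_closure_regularLocus (hSL : G ≤ W.SL) :
    {p : ℂ × ℂ | 0 < p.2.im} ⊆ closure (regularLocus W G) := by
  intro p₀ hp₀
  obtain ⟨g, a, b, h0, hg⟩ := exists_ellQuotient_local_extension hSL hp₀
  have hev : ∀ᶠ z in 𝓝 p₀.1, z ≠ a * p₀.2 + b → (z, p₀.2) ∈ regularLocus W G := by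
    have hc : Filter.Tendsto (fun z : ℂ => (z, p₀.2)) (𝓝 p₀.1) (𝓝 p₀) :=
      (by fun_prop : Continuous fun z : ℂ => (z, p₀.2)).tendsto' _ _ rfl
    exact (hc.eventually hg).mono fun z hz => hz.2.2
  -- On the slice of constant `τ` the curve consists of a single point.
  have hfreq : ∃ᶠ z in 𝓝[≠] p₀.1, (z, p₀.2) ∈ regularLocus W G := by
    refine Filter.Eventually.frequently ?_
    rw [eventually_nhdsWithin_iff]
    refine hev.mono fun z hz hne => hz ?_
    rw [← h0]
    exact hne
  have hc : Filter.Tendsto (fun z : ℂ => (z, p₀.2)) (𝓝[≠] p₀.1) (𝓝 p₀) :=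
    ((by fun_prop : Continuous fun z : ℂ => (z, p₀.2)).tendsto' _ _ rfl).mono_left
      nhdsWithin_le_nhds
  exact mem_closure_iff_frequently.2 (hc.frequently hfreq)

theorem Ell_eventuallyEq (hSL : G ≤ W.SL) {p₀ : ℂ × ℂ} (hp₀ : 0 < p₀.2.im) :
    ∃ g : ℂ × ℂ → ℂ, DifferentiableAt ℂ g p₀ ∧ (fun p => Ell W G p.1 p.2) =ᶠ[𝓝 p₀] g ∧
      (p₀ ∈ regularLocus W G → ellQuotient W G p₀ = g p₀) := by
  obtain ⟨g, a, b, -, hg⟩ := exists_ellQuotient_local_extension hSL hp₀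
  have hU : ∀ᶠ p in 𝓝 p₀, 0 < p.2.im :=
    (isOpen_lt continuous_const (Complex.continuous_im.comp continuous_snd)).mem_nhds hp₀
  refine ⟨g, hg.self_of_nhds.1, ?_, hg.self_of_nhds.2.1⟩
  filter_upwards [hg.eventually_nhds, hU] with p hp hpU
  refine extendFrom_eq (subset_closure_regularLocus hSL hpU) ?_
  have h1 : Filter.Tendsto g (𝓝[regularLocus W G] p) (𝓝 (g p)) :=
    hp.self_of_nhds.1.continuousAt.tendsto.mono_left nhdsWithin_le_nhds
  refine h1.congr' ?_
  rw [Filter.EventuallyEq, eventually_nhdsWithin_iff]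
  exact hp.mono fun x hx hreg => (hx.2.1 hreg).symm

theorem Ell_eq_ellQuotient (hSL : G ≤ W.SL) {p : ℂ × ℂ} (hp : p ∈ regularLocus W G) :
    Ell W G p.1 p.2 = ellQuotient W G p := by
  obtain ⟨g, -, h1, h2⟩ := Ell_eventuallyEq hSL hp.1
  rw [h2 hp]
  exact h1.self_of_nhds

theorem differentiableOn_Ell (hSL : G ≤ W.SL) :
    DifferentiableOn ℂ (fun p : ℂ × ℂ => Ell W G p.1 p.2) {p | 0 < p.2.im} := by
  intro p hp
  obtain ⟨g, hg, h1, -⟩ := Ell_eventuallyEq hSL hp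
  exact (hg.congr_of_eventuallyEq h1).differentiableWithinAt

theorem isOpen_regularLocus (hSL : G ≤ W.SL) : IsOpen (regularLocus W G) := by
  have := finite_of_le_SL hSL
  have hU : IsOpen {p : ℂ × ℂ | 0 < p.2.im} :=
    isOpen_lt continuous_const (Complex.continuous_im.comp continuous_snd)
  rw [isOpen_iff_mem_nhds]
  intro p hp
  have h : ∀ᶠ p in 𝓝 p, ∀ (γ δ : G) (j : Fin d),
      Theta (W.q j * p.1 + theta j γ * p.2 + theta j δ) p.2 ≠ 0 := by
    refine Filter.eventually_all.2 fun γ => Filter.eventually_all.2 fun δ =>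
      Filter.eventually_all.2 fun j => ?_
    refine ContinuousAt.eventually_ne (g := fun p : ℂ × ℂ =>
      Theta (W.q j * p.1 + theta j γ * p.2 + theta j δ) p.2) ?_ (hp.2 γ γ.2 δ δ.2 j)
    have h1 := (differentiableOn_Theta.comp (s := {p : ℂ × ℂ | 0 < p.2.im})
      (f := fun p : ℂ × ℂ => ((W.q j * p.1 + theta j γ * p.2 + theta j δ : ℂ), p.2))
      (by fun_prop) fun p hp => hp)
    exact (h1.differentiableAt (hU.mem_nhds hp.1)).continuousAt
  filter_upwards [h, hU.mem_nhds hp.1] with x hx hxU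
  exact ⟨hxU, fun γ hγ δ hδ j => hx ⟨γ, hγ⟩ ⟨δ, hδ⟩ j⟩

/-- A transformation law of the quotient of theta functions passes to the elliptic genus, as it
holds on the dense set of the regular points with a regular image. -/
theorem Ell_comp_eq (hSL : G ≤ W.SL) {φ ψ : ℂ × ℂ → ℂ × ℂ} {c : ℂ × ℂ → ℂ}
    (hφ : ContinuousOn φ {p | 0 < p.2.im}) (hψ : ContinuousOn ψ {p | 0 < p.2.im})
    (hc : ContinuousOn c {p | 0 < p.2.im})
    (hφm : Set.MapsTo φ {p | 0 < p.2.im} {p | 0 < p.2.im})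
    (hψφ : ∀ p : ℂ × ℂ, 0 < p.2.im → ψ (φ p) = p) (hφψ : ∀ p : ℂ × ℂ, 0 < p.2.im → φ (ψ p) = p)
    (h : ∀ p : ℂ × ℂ, 0 < p.2.im → ellQuotient W G (φ p) = c p * ellQuotient W G p)
    {p : ℂ × ℂ} (hp : 0 < p.2.im) :
    Ell W G (φ p).1 (φ p).2 = c p * Ell W G p.1 p.2 := by
  have hU : IsOpen {p : ℂ × ℂ | 0 < p.2.im} :=
    isOpen_lt continuous_const (Complex.continuous_im.comp continuous_snd)
  have hEll := (differentiableOn_Ell hSL).continuousOn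
  set R := regularLocus W G with hR
  have hRU : R ⊆ {p | 0 < p.2.im} := fun p hp => hp.1
  have hdense : p ∈ closure (R ∩ φ ⁻¹' R) := by
    rw [mem_closure_iff]
    intro V hV hpV
    obtain ⟨x, hxV, hxR⟩ := mem_closure_iff.1 (subset_closure_regularLocus hSL hp) V hV hpV
    have hφx := hφm (hRU hxR)
    have hnhds : ψ ⁻¹' (V ∩ R) ∈ 𝓝 (φ x) := by
      refine (hψ.continuousAt (hU.mem_nhds hφx)).preimage_mem_nhds ?_
      rw [hψφ x (hRU hxR)]
      exact (hV.inter (isOpen_regularLocus hSL)).mem_nhds ⟨hxV, hxR⟩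
    obtain ⟨y, hy, hyR⟩ := mem_closure_iff_nhds.1 (subset_closure_regularLocus hSL hφx) _ hnhds
    refine ⟨ψ y, hy.1, hy.2, ?_⟩
    rw [Set.mem_preimage, hφψ y (hRU hyR)]
    exact hyR
  have hne : (𝓝[R ∩ φ ⁻¹' R] p).NeBot := mem_closure_iff_nhdsWithin_neBot.1 hdense
  have hle : 𝓝[R ∩ φ ⁻¹' R] p ≤ 𝓝[{p | 0 < p.2.im}] p :=
    nhdsWithin_mono _ (Set.inter_subset_left.trans hRU)
  have h1 := ((hEll.comp hφ hφm) p hp).mono_left hle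
  have h2 := ((hc.mul hEll) p hp).mono_left hle
  refine tendsto_nhds_unique_of_eventuallyEq h1 h2 ?_
  filter_upwards [self_mem_nhdsWithin] with x hx
  simp only [Function.comp_apply, Pi.mul_apply]
  rw [Ell_eq_ellQuotient hSL hx.2, Ell_eq_ellQuotient hSL hx.1]
  exact h x (hRU hx.1)

theorem Ell_z_add_one (hSL : G ≤ W.SL) (hJ : W.J ∈ G) (z : ℂ) {τ : ℂ} (hτ : 0 < τ.im) :
    Ell W G (z + 1) τ = (-1) ^ d * Ell W G z τ :=
  Ell_comp_eq hSL (φ := fun p => (p.1 + 1, p.2)) (ψ := fun p => (p.1 - 1, p.2))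
    (c := fun _ => (-1) ^ d) (by fun_prop) (by fun_prop) (by fun_prop) (fun p hp => hp)
    (fun p _ => by simp) (fun p _ => by simp) (fun p hp => ellQuotient_z_add_one hSL hJ p.1 hp)
    (p := (z, τ)) hτ

theorem Ell_z_add_tau (hSL : G ≤ W.SL) (hJ : W.J ∈ G) (z : ℂ) {τ : ℂ} (hτ : 0 < τ.im) :
    Ell W G (z + τ) τ = (-1) ^ d *
      Complex.exp (-(Complex.I * Real.pi * W.cHat * (τ + 2 * z))) * Ell W G z τ :=
  Ell_comp_eq hSL (φ := fun p => (p.1 + p.2, p.2)) (ψ := fun p => (p.1 - p.2, p.2))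
    (c := fun p => (-1) ^ d * Complex.exp (-(Complex.I * Real.pi * W.cHat * (p.2 + 2 * p.1))))
    (by fun_prop) (by fun_prop) (by fun_prop) (fun p hp => hp)
    (fun p _ => by simp) (fun p _ => by simp) (fun p hp => ellQuotient_z_add_tau hSL hJ p.1 hp)
    (p := (z, τ)) hτ

theorem Ell_tau_add_one (hSL : G ≤ W.SL) (z : ℂ) {τ : ℂ} (hτ : 0 < τ.im) :
    Ell W G z (τ + 1) = Ell W G z τ := by
  have := Ell_comp_eq hSL (φ := fun p => (p.1, p.2 + 1)) (ψ := fun p => (p.1, p.2 - 1))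
    (c := fun _ => 1) (by fun_prop) (by fun_prop) (by fun_prop) (fun p hp => by simpa using hp)
    (fun p _ => by simp) (fun p _ => by simp)
    (fun p hp => by rw [one_mul]; exact ellQuotient_tau_add_one hSL p.1 hp) (p := (z, τ)) hτ
  simpa using this

theorem Ell_inversion (hSL : G ≤ W.SL) (z : ℂ) {τ : ℂ} (hτ : 0 < τ.im) :
    Ell W G (z / τ) (-1 / τ) =
      Complex.exp (Complex.I * Real.pi * W.cHat * z ^ 2 / τ) * Ell W G z τ := by
  have h0 (p : ℂ × ℂ) (hp : 0 < p.2.im) : p.2 ≠ 0 := by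
    intro h
    simp [h] at hp
  exact Ell_comp_eq hSL (φ := fun p => (p.1 / p.2, -1 / p.2)) (ψ := fun p => (-p.1 / p.2, -1 / p.2))
    (c := fun p => Complex.exp (Complex.I * Real.pi * W.cHat * p.1 ^ 2 / p.2))
    (by fun_prop (disch := exact h0)) (by fun_prop (disch := exact h0))
    (by fun_prop (disch := exact h0)) (fun p hp => im_neg_one_div_pos hp)
    (fun p hp => Prod.ext (by have := h0 p hp; simp; field_simp) (by simp))
    (fun p hp => Prod.ext (by have := h0 p hp; simp; field_simp) (by simp))
    (fun p hp => ellQuotient_inversion hSL p.1 hp) (p := (z, τ)) hτ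

/-! ### From generators to the modular group and the lattice -/

theorem denom_ne_zero_of_im_pos (g : Matrix.SpecialLinearGroup (Fin 2) ℤ) {τ : ℂ} (hτ : 0 < τ.im) :
    (g 1 0 : ℂ) * τ + g 1 1 ≠ 0 := by
  have := UpperHalfPlane.denom_ne_zero (g : Matrix.GeneralLinearGroup (Fin 2) ℝ) ⟨τ, hτ⟩
  rwa [ModularGroup.denom_apply] at this

theorem im_moebius_pos (g : Matrix.SpecialLinearGroup (Fin 2) ℤ) {τ : ℂ} (hτ : 0 < τ.im) :
    0 < (((g 0 0 : ℂ) * τ + g 0 1) / ((g 1 0 : ℂ) * τ + g 1 1)).im := by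
  have h := (g • (⟨τ, hτ⟩ : UpperHalfPlane)).im_pos
  rw [← UpperHalfPlane.coe_im, UpperHalfPlane.coe_specialLinearGroup_apply] at h
  simpa using h

/-- The action of `SL(2, ℤ)` on pairs `(z, τ)`. -/
def jacobiAct (g : Matrix.SpecialLinearGroup (Fin 2) ℤ) (p : ℂ × ℂ) : ℂ × ℂ :=
  (p.1 / ((g 1 0 : ℂ) * p.2 + g 1 1),
    ((g 0 0 : ℂ) * p.2 + g 0 1) / ((g 1 0 : ℂ) * p.2 + g 1 1))

/-- The exponent `c z ^ 2 / (c τ + e)` in the modular transformation law of a Jacobi form. It is an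
additive cocycle for `jacobiAct`. -/
def jacobiCocycle (g : Matrix.SpecialLinearGroup (Fin 2) ℤ) (p : ℂ × ℂ) : ℂ :=
  (g 1 0 : ℂ) * p.1 ^ 2 / ((g 1 0 : ℂ) * p.2 + g 1 1)

theorem coe_mul_apply (g h : Matrix.SpecialLinearGroup (Fin 2) ℤ) (i j : Fin 2) :
    (((g * h) i j : ℤ) : ℂ) = g i 0 * h 0 j + g i 1 * h 1 j := by
  rw [Matrix.SpecialLinearGroup.coe_mul, Matrix.mul_apply, Fin.sum_univ_two]
  push_cast
  rfl

theorem denom_mul (g h : Matrix.SpecialLinearGroup (Fin 2) ℤ) {p : ℂ × ℂ} (hp : 0 < p.2.im) :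
    ((g * h) 1 0 : ℂ) * p.2 + (g * h) 1 1 =
      ((g 1 0 : ℂ) * (jacobiAct h p).2 + g 1 1) * ((h 1 0 : ℂ) * p.2 + h 1 1) := by
  have h1 := denom_ne_zero_of_im_pos h hp
  rw [jacobiAct, coe_mul_apply, coe_mul_apply]
  field_simp
  ring

theorem jacobiAct_mul (g h : Matrix.SpecialLinearGroup (Fin 2) ℤ) {p : ℂ × ℂ} (hp : 0 < p.2.im) :
    jacobiAct (g * h) p = jacobiAct g (jacobiAct h p) := by
  have h1 := denom_ne_zero_of_im_pos h hp
  have h2 : (g 1 0 : ℂ) * (jacobiAct h p).2 + g 1 1 ≠ 0 :=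
    denom_ne_zero_of_im_pos g (im_moebius_pos h hp)
  refine Prod.ext ?_ ?_
  · rw [jacobiAct, denom_mul g h hp, jacobiAct, mul_comm, ← div_div]
    rfl
  · change ((g * h) 0 0 * p.2 + (g * h) 0 1 : ℂ) / ((g * h) 1 0 * p.2 + (g * h) 1 1) =
      (g 0 0 * (jacobiAct h p).2 + g 0 1) / (g 1 0 * (jacobiAct h p).2 + g 1 1)
    rw [denom_mul g h hp, div_eq_div_iff (mul_ne_zero h2 h1) h2, coe_mul_apply, coe_mul_apply]
    have h3 : (jacobiAct h p).2 * ((h 1 0 : ℂ) * p.2 + h 1 1) = (h 0 0 : ℂ) * p.2 + h 0 1 := by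
      rw [jacobiAct, div_mul_cancel₀ _ h1]
    linear_combination (-(g 0 0 : ℂ) * ((g 1 0 : ℂ) * (jacobiAct h p).2 + g 1 1)) * h3

theorem jacobiCocycle_mul (g h : Matrix.SpecialLinearGroup (Fin 2) ℤ) {p : ℂ × ℂ}
    (hp : 0 < p.2.im) :
    jacobiCocycle (g * h) p = jacobiCocycle g (jacobiAct h p) + jacobiCocycle h p := by
  have h1 := denom_ne_zero_of_im_pos h hp
  have h2 : (g 1 0 : ℂ) * (jacobiAct h p).2 + g 1 1 ≠ 0 :=
    denom_ne_zero_of_im_pos g (im_moebius_pos h hp)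
  have h3 : (jacobiAct h p).2 * ((h 1 0 : ℂ) * p.2 + h 1 1) = (h 0 0 : ℂ) * p.2 + h 0 1 := by
    rw [jacobiAct, div_mul_cancel₀ _ h1]
  have h4 : (jacobiAct h p).1 = p.1 / ((h 1 0 : ℂ) * p.2 + h 1 1) := rfl
  have hdet : (h 0 0 : ℂ) * h 1 1 - h 0 1 * h 1 0 = 1 := by
    have := Matrix.SpecialLinearGroup.det_coe h
    rw [Matrix.det_fin_two] at this
    exact_mod_cast this
  rw [jacobiCocycle, denom_mul g h hp, jacobiCocycle, jacobiCocycle, h4, coe_mul_apply]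
  field_simp
  linear_combination (-p.1 ^ 2 * (h 1 0 : ℂ) * g 1 0) * h3 + (p.1 ^ 2 * (g 1 0 : ℂ)) * hdet

theorem jacobiAct_one (p : ℂ × ℂ) : jacobiAct 1 p = p := by
  simp [jacobiAct]

theorem jacobiCocycle_one (p : ℂ × ℂ) : jacobiCocycle 1 p = 0 := by
  simp [jacobiCocycle]

/-- Invariance of weight `0` under the two generators of the modular group implies invariance under
the whole group. -/
theorem modular_of_generators {φ : ℂ × ℂ → ℂ} {K : ℂ}
    (hT : ∀ p : ℂ × ℂ, 0 < p.2.im → φ (p.1, p.2 + 1) = φ p)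
    (hS : ∀ p : ℂ × ℂ, 0 < p.2.im →
      φ (p.1 / p.2, -1 / p.2) = Complex.exp (K * (p.1 ^ 2 / p.2)) * φ p)
    (g : Matrix.SpecialLinearGroup (Fin 2) ℤ) {p : ℂ × ℂ} (hp : 0 < p.2.im) :
    φ (jacobiAct g p) = Complex.exp (K * jacobiCocycle g p) * φ p := by
  have hg : g ∈ Subgroup.closure {ModularGroup.S, ModularGroup.T} := by
    rw [SpecialLinearGroup.SL2Z_generators]
    exact Subgroup.mem_top g
  induction hg using Subgroup.closure_induction generalizing p with
  | mem g hg =>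
    rcases hg with rfl | rfl
    · simpa [jacobiAct, jacobiCocycle, ModularGroup.S] using hS p hp
    · simpa [jacobiAct, jacobiCocycle, ModularGroup.T] using hT p hp
  | one => rw [jacobiAct_one, jacobiCocycle_one, mul_zero, Complex.exp_zero, one_mul]
  | mul g h _ _ ihg ihh =>
    rw [jacobiAct_mul g h hp, ihg (im_moebius_pos h hp), ihh hp, jacobiCocycle_mul g h hp, mul_add,
      Complex.exp_add, mul_assoc]
  | inv g _ ih =>
    -- The law for `g` at the point `g⁻¹ p`.
    have h1 := ih (p := jacobiAct g⁻¹ p) (im_moebius_pos g⁻¹ hp)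
    have h2 := jacobiCocycle_mul g g⁻¹ hp
    rw [mul_inv_cancel, jacobiCocycle_one] at h2
    rw [← jacobiAct_mul g g⁻¹ hp, mul_inv_cancel, jacobiAct_one] at h1
    rw [h1, ← mul_assoc, ← Complex.exp_add, ← mul_add, add_comm, ← h2, mul_zero, Complex.exp_zero,
      one_mul]

/-- Quasi-periodicity under `1` and `τ` implies quasi-periodicity under the lattice they span. -/
theorem elliptic_of_generators {φ : ℂ → ℂ} {ε K τ : ℂ} (hε : ε ≠ 0)
    (h1 : ∀ z, φ (z + 1) = ε * φ z)
    (hτ : ∀ z, φ (z + τ) = ε * Complex.exp (-(K * (τ + 2 * z))) * φ z) (l m : ℤ) (z : ℂ) :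
    φ (z + l * τ + m) =
      ε ^ (l + m) * Complex.exp (-(K * ((l : ℂ) ^ 2 * τ + 2 * l * z))) * φ z := by
  have hm (z : ℂ) (m : ℤ) : φ (z + m) = ε ^ m * φ z := by
    have step (m : ℤ) : φ (z + (m + 1 : ℤ)) = ε ^ (m + 1) * φ z ↔ φ (z + m) = ε ^ m * φ z := by
      push_cast
      rw [← add_assoc, h1, zpow_add_one₀ hε, mul_comm (ε ^ m), mul_assoc, mul_right_inj' hε]
    induction m with
    | zero => simp
    | succ m ih => exact (step m).2 ih
    | pred m ih => exact (step _).1 (by simpa using ih)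
  have hl (l : ℤ) : φ (z + l * τ) =
      ε ^ l * Complex.exp (-(K * ((l : ℂ) ^ 2 * τ + 2 * l * z))) * φ z := by
    have step (l : ℤ) : φ (z + (l + 1 : ℤ) * τ) =
          ε ^ (l + 1) * Complex.exp (-(K * (((l + 1 : ℤ) : ℂ) ^ 2 * τ + 2 * (l + 1 : ℤ) * z))) *
            φ z ↔
        φ (z + l * τ) = ε ^ l * Complex.exp (-(K * ((l : ℂ) ^ 2 * τ + 2 * l * z))) * φ z := by
      have he : Complex.exp (-(K * (((l + 1 : ℤ) : ℂ) ^ 2 * τ + 2 * (l + 1 : ℤ) * z))) =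
          Complex.exp (-(K * (τ + 2 * (z + l * τ)))) *
            Complex.exp (-(K * ((l : ℂ) ^ 2 * τ + 2 * l * z))) := by
        rw [← Complex.exp_add]
        push_cast
        ring_nf
      rw [show z + ((l + 1 : ℤ) : ℂ) * τ = z + l * τ + τ by push_cast; ring, hτ, he,
        zpow_add_one₀ hε, ← mul_right_inj' (b := φ (z + l * τ))
          (mul_ne_zero hε (Complex.exp_ne_zero (-(K * (τ + 2 * (z + l * τ))))))]
      simp only [mul_assoc, mul_left_comm]
    induction l with
    | zero => simp
    | succ m ih => exact (step m).2 ih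
    | pred m ih => exact (step _).1 (by simpa using ih)
  rw [hm, hl, zpow_add₀ hε]
  ring

/-! ### Behaviour at the cusp -/

theorem norm_qProd_bounds {x q : ℂ} (hq : ‖q‖ ≤ 1 / 8) (hx : ‖q * x‖ ≤ 1 / 8) :
    1 / 2 ≤ ‖qProd x q‖ ∧ ‖qProd x q‖ ≤ 3 / 2 := by
  have h1 := norm_qProd_sub_one_le x (hq.trans_lt (by norm_num))
  have h2 : ‖q * x‖ / (1 - ‖q‖) ≤ 1 / 4 := by
    rw [div_le_iff₀ (by linarith)]
    linarith
  have h3 : Real.exp (1 / 4) - 1 ≤ 1 / 2 := by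
    have := Real.abs_exp_sub_one_le (x := 1 / 4) (by norm_num [abs_of_pos])
    rw [abs_of_pos (by norm_num : (0 : ℝ) < 1 / 4)] at this
    linarith [le_abs_self (Real.exp (1 / 4) - 1)]
  have h4 : ‖qProd x q - 1‖ ≤ 1 / 2 := by
    have := Real.exp_le_exp.2 h2
    linarith
  have h5 := norm_sub_norm_le (qProd x q) 1
  have h6 := norm_sub_norm_le 1 (qProd x q)
  rw [norm_sub_rev] at h6
  rw [norm_one] at h5 h6
  constructor <;> linarith

/-- High up in the upper half plane, `Θ(ν, τ)` is comparable to
`exp (-i π ν) (1 - exp (2 π i ν))`, up to a factor that depends on `τ` only. -/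
theorem exists_norm_Theta_bounds {τ : ℂ} (hτ : 0 < τ.im)
    (hq : Real.exp (-(2 * Real.pi * τ.im)) ≤ 1 / 8) :
    ∃ C : ℝ, 0 < C ∧ ∀ ν : ℂ, Real.exp (-(2 * Real.pi * (τ.im + ν.im))) ≤ 1 / 8 →
      Real.exp (-(2 * Real.pi * (τ.im - ν.im))) ≤ 1 / 8 →
      C * (Real.exp (Real.pi * ν.im) * ‖1 - Complex.exp (2 * Real.pi * Complex.I * ν)‖) ≤
        ‖Theta ν τ‖ ∧ ‖Theta ν τ‖ ≤
      9 * C * (Real.exp (Real.pi * ν.im) * ‖1 - Complex.exp (2 * Real.pi * Complex.I * ν)‖) := by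
  set Q := Complex.exp (2 * Real.pi * Complex.I * τ) with hQ
  have hnorm (w : ℂ) : ‖Complex.exp (2 * Real.pi * Complex.I * w)‖ =
      Real.exp (-(2 * Real.pi * w.im)) := by
    rw [Complex.norm_exp]
    simp
  have hQn : ‖Q‖ ≤ 1 / 8 := by rwa [hQ, hnorm]
  have h1 := (norm_qProd_bounds (x := 1) hQn (by rwa [mul_one])).1
  set K := ‖Complex.I * Complex.exp (2 * Real.pi * Complex.I * τ / 8)‖ with hK
  have hK0 : 0 < K := norm_pos_iff.2 (mul_ne_zero Complex.I_ne_zero (Complex.exp_ne_zero _))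
  refine ⟨K * ‖qProd 1 Q‖ / 4, by positivity, fun ν ha hb => ?_⟩
  have h2 := norm_qProd_bounds (x := Complex.exp (2 * Real.pi * Complex.I * ν)) hQn (by
    rwa [hQ, ← Complex.exp_add, ← mul_add, hnorm, Complex.add_im])
  have h3 := norm_qProd_bounds (x := Complex.exp (-(2 * Real.pi * Complex.I * ν))) hQn (by
    rwa [hQ, ← Complex.exp_add, ← sub_eq_add_neg, ← mul_sub, hnorm, Complex.sub_im])
  have h4 : ‖Complex.exp (-(Complex.I * Real.pi * ν))‖ = Real.exp (Real.pi * ν.im) := by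
    rw [Complex.norm_exp]
    simp
  have h5 : ‖Theta ν τ‖ = K * ‖qProd 1 Q‖ *
      (Real.exp (Real.pi * ν.im) * ‖1 - Complex.exp (2 * Real.pi * Complex.I * ν)‖) *
      (‖qProd (Complex.exp (2 * Real.pi * Complex.I * ν)) Q‖ *
        ‖qProd (Complex.exp (-(2 * Real.pi * Complex.I * ν))) Q‖) := by
    rw [Theta_eq _ hτ, ← hQ, hK]
    simp only [norm_mul, h4]
    ring
  set X := K * ‖qProd 1 Q‖ *
    (Real.exp (Real.pi * ν.im) * ‖1 - Complex.exp (2 * Real.pi * Complex.I * ν)‖) with hX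
  have hX0 : 0 ≤ X := by positivity
  have h6 : 1 / 4 ≤ ‖qProd (Complex.exp (2 * Real.pi * Complex.I * ν)) Q‖ *
      ‖qProd (Complex.exp (-(2 * Real.pi * Complex.I * ν))) Q‖ := by
    have := mul_le_mul h2.1 h3.1 (by norm_num) (norm_nonneg _)
    linarith
  have h7 : ‖qProd (Complex.exp (2 * Real.pi * Complex.I * ν)) Q‖ *
      ‖qProd (Complex.exp (-(2 * Real.pi * Complex.I * ν))) Q‖ ≤ 9 / 4 := by
    have := mul_le_mul h2.2 h3.2 (norm_nonneg _) (by norm_num)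
    linarith
  rw [h5]
  constructor
  · calc _ = X * (1 / 4) := by rw [hX]; ring
      _ ≤ _ := by gcongr
  · calc _ ≤ X * (9 / 4) := by gcongr
      _ = _ := by rw [hX]; ring

open Filter in
theorem eventually_exp_le (a : ℝ) {b : ℝ} (hb : 0 < b) :
    ∀ᶠ t in atTop, Real.exp (2 * Real.pi * (a - b * t)) ≤ 1 / 8 := by
  have h1 : Tendsto (fun t : ℝ => 2 * Real.pi * (a - b * t)) atTop atBot := by
    refine Tendsto.const_mul_atBot (by positivity) ?_
    exact tendsto_atBot_add_const_left _ a
      (tendsto_neg_atTop_atBot.comp (tendsto_id.const_mul_atTop hb))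
  exact (Real.tendsto_exp_atBot.comp h1).eventually_le_const (by norm_num)

open Filter in
/-- On the line `Im z = 1`, which avoids the poles near the cusp, the factors of the summands stay
bounded as `Im τ` tends to infinity: the powers of `exp (2 π i τ)` cancel, for `0 ≤ u < 1`. -/
theorem eventually_norm_thetaQuot_le {q u : ℝ} (hq : 0 < q) (hu0 : 0 ≤ u) (hu1 : u < 1) :
    ∃ B : ℝ, ∀ᶠ t : ℝ in atTop, ∀ (v : ℝ) (z τ : ℂ), z.im = 1 → τ.im = t →
      Theta (q * z + u * τ + v) τ ≠ 0 ∧ ‖thetaQuot q u v z τ‖ ≤ B := by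
  have hexpq : Real.exp (-(2 * Real.pi * q)) < 1 := by
    rw [Real.exp_lt_one_iff]
    have := Real.pi_pos
    nlinarith [mul_pos this hq]
  refine ⟨Real.exp (2 * Real.pi * u) * (9 * (Real.exp (Real.pi * (1 - 2 * q)) *
    (1 + Real.exp (-(2 * Real.pi * (1 - q))))) / (1 - Real.exp (-(2 * Real.pi * q)))), ?_⟩
  filter_upwards [eventually_gt_atTop 0, eventually_exp_le 0 one_pos,
    eventually_exp_le (1 + q) (sub_pos.2 hu1)] with t ht he1 he2 v z τ hz hτ
  subst hτ
  set t := τ.im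
  have hut : 0 ≤ u * t := by positivity
  obtain ⟨C, hC, hbd⟩ := exists_norm_Theta_bounds ht (by
    rw [zero_sub, one_mul, mul_neg] at he1
    exact he1)
  have hle {y : ℝ} (hy : -y ≤ 1 + q - (1 - u) * t) : Real.exp (-(2 * Real.pi * y)) ≤ 1 / 8 := by
    refine le_trans (Real.exp_le_exp.2 ?_) he2
    have := mul_le_mul_of_nonneg_left hy (by positivity : (0 : ℝ) ≤ 2 * Real.pi)
    linarith
  have imD : (q * z + u * τ + v : ℂ).im = q + u * t := by simp [hz, t]
  have imN : ((1 - q) * z - u * τ - v : ℂ).im = 1 - q - u * t := by simp [hz, t]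
  have hnorm (w : ℂ) : ‖Complex.exp (2 * Real.pi * Complex.I * w)‖ =
      Real.exp (-(2 * Real.pi * w.im)) := by
    rw [Complex.norm_exp]
    simp
  -- The imaginary parts of both arguments are at most `1 + q + u Im τ` in absolute value, hence
  -- less than `Im τ` by a margin, and the bounds for `Θ` apply.
  have hD := (hbd (q * z + u * τ + v) (hle (by rw [imD]; linarith)) (hle (by rw [imD]; linarith))).1
  have hN := (hbd ((1 - q) * z - u * τ - v) (hle (by rw [imN]; linarith))
    (hle (by rw [imN]; linarith))).2
  have hD1 : 1 - Real.exp (-(2 * Real.pi * q)) ≤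
      ‖1 - Complex.exp (2 * Real.pi * Complex.I * (q * z + u * τ + v))‖ := by
    have h := norm_sub_norm_le 1 (Complex.exp (2 * Real.pi * Complex.I * (q * z + u * τ + v)))
    rw [norm_one, hnorm, imD] at h
    have : Real.exp (-(2 * Real.pi * (q + u * t))) ≤ Real.exp (-(2 * Real.pi * q)) := by
      gcongr
      linarith
    linarith
  have hN1 : ‖1 - Complex.exp (2 * Real.pi * Complex.I * ((1 - q) * z - u * τ - v))‖ ≤
      1 + Real.exp (-(2 * Real.pi * (1 - q - u * t))) := by
    have h := norm_sub_le 1 (Complex.exp (2 * Real.pi * Complex.I * ((1 - q) * z - u * τ - v)))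
    rwa [norm_one, hnorm, imN] at h
  rw [imD] at hD
  rw [imN] at hN
  have hq1 : 0 < 1 - Real.exp (-(2 * Real.pi * q)) := sub_pos.2 hexpq
  have hD2 : C * (Real.exp (Real.pi * (q + u * t)) * (1 - Real.exp (-(2 * Real.pi * q)))) ≤
      ‖Theta (q * z + u * τ + v) τ‖ := le_trans (by gcongr) hD
  have hpos : 0 < ‖Theta (q * z + u * τ + v) τ‖ := lt_of_lt_of_le (by positivity) hD2
  refine ⟨norm_pos_iff.1 hpos, ?_⟩
  have hN2 : ‖Theta ((1 - q) * z - u * τ - v) τ‖ ≤ 9 * C * (Real.exp (Real.pi * (1 - q - u * t)) *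
      (1 + Real.exp (-(2 * Real.pi * (1 - q - u * t))))) := hN.trans (by gcongr)
  -- The growth `exp (π u t)` of the numerator is that of the denominator.
  have hexp : Real.exp (Real.pi * (1 - q - u * t)) *
      (1 + Real.exp (-(2 * Real.pi * (1 - q - u * t)))) ≤
      Real.exp (Real.pi * (1 - 2 * q)) * (1 + Real.exp (-(2 * Real.pi * (1 - q)))) *
        Real.exp (Real.pi * (q + u * t)) := by
    rw [mul_add, mul_add, add_mul, mul_one, mul_one, ← Real.exp_add, ← Real.exp_add,
      ← Real.exp_add, ← Real.exp_add]
    have := mul_nonneg Real.pi_pos.le hut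
    gcongr ?_ + ?_ <;> refine Real.exp_le_exp.2 ?_ <;> linarith
  rw [thetaQuot, norm_mul, norm_div]
  have h0 : ‖Complex.exp (-(2 * Real.pi * Complex.I * z * u))‖ = Real.exp (2 * Real.pi * u) := by
    rw [Complex.norm_exp]
    simp [hz]
  rw [h0]
  refine mul_le_mul_of_nonneg_left ?_ (Real.exp_pos _).le
  rw [div_le_div_iff₀ hpos hq1]
  calc _ ≤ 9 * C * (Real.exp (Real.pi * (1 - 2 * q)) * (1 + Real.exp (-(2 * Real.pi * (1 - q)))) *
        Real.exp (Real.pi * (q + u * t))) * (1 - Real.exp (-(2 * Real.pi * q))) := by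
        gcongr
        exact hN2.trans (by gcongr)
    _ = 9 * (Real.exp (Real.pi * (1 - 2 * q)) * (1 + Real.exp (-(2 * Real.pi * (1 - q))))) *
        (C * (Real.exp (Real.pi * (q + u * t)) * (1 - Real.exp (-(2 * Real.pi * q))))) := by ring
    _ ≤ _ := by gcongr

open Filter in
theorem eventually_norm_Ell_le (hSL : G ≤ W.SL) :
    ∃ B : ℝ, ∀ᶠ t : ℝ in atTop, ∀ z τ : ℂ, z.im = 1 → τ.im = t → ‖Ell W G z τ‖ ≤ B := by
  have := finite_of_le_SL hSL
  have := Fintype.ofFinite G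
  choose B hB using fun (γ : G) (j : Fin d) =>
    eventually_norm_thetaQuot_le (Rat.cast_pos.2 (W.q_pos j)) (theta_mem_Ico j γ.1).1
      (theta_mem_Ico j γ.1).2
  refine ⟨‖1 / (Nat.card G : ℂ)‖ * ∑ γ : G, ∑ _δ : G, ∏ j, B γ j, ?_⟩
  filter_upwards [eventually_gt_atTop 0,
    eventually_all.2 fun γ => eventually_all.2 fun j => hB γ j] with t ht h z τ hz hτ
  have hreg : (z, τ) ∈ regularLocus W G := by
    refine ⟨by simpa [hτ] using ht, fun γ hγ δ _ j => ?_⟩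
    simpa using (h ⟨γ, hγ⟩ j (theta j δ) z τ hz hτ).1
  rw [Ell_eq_ellQuotient hSL hreg, ellQuotient_eq, norm_mul]
  gcongr
  refine norm_sum_le_of_le _ fun γ _ => norm_sum_le_of_le _ fun δ _ => ?_
  rw [ellTerm, norm_prod]
  refine Finset.prod_le_prod (fun _ _ => norm_nonneg _) fun j _ => ?_
  simpa using (h γ j (theta j δ) z τ hz hτ).2

open Filter in
/-- A holomorphic function that is `1`-periodic in both variables and bounded for `Im z = 1` and
`Im τ → ∞` has no negative powers of `exp (2 π i τ)` in its Fourier expansion. -/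
theorem torusCoeff_eq_zero_of_bounded {F : ℂ → ℂ → ℂ}
    (hF : DifferentiableOn ℂ (fun p : ℂ × ℂ => F p.1 p.2) {p | 0 < p.2.im})
    (hz : ∀ z τ, 0 < τ.im → F (z + 1) τ = F z τ) (hτ : ∀ z τ, 0 < τ.im → F z (τ + 1) = F z τ)
    {B : ℝ} (hB : ∀ᶠ t : ℝ in atTop, ∀ z τ : ℂ, z.im = 1 → τ.im = t → ‖F z τ‖ ≤ B)
    {n : ℤ} (hn : n < 0) (l : ℤ) : torusCoeff F 1 1 n l = 0 := by
  have h1 : ∀ᶠ t : ℝ in atTop, ‖torusCoeff F 1 1 n l‖ ≤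
      B * Real.exp (2 * Real.pi * l * 1) * Real.exp (2 * Real.pi * n * t) := by
    filter_upwards [hB, eventually_gt_atTop 0] with t ht ht0
    rw [torusCoeff_eq hF hz hτ 1 1 one_pos ht0]
    exact norm_torusCoeff_le (fun x _ s _ => ht _ _ (by simp) (by simp)) n l
  have h2 : Tendsto (fun t : ℝ => B * Real.exp (2 * Real.pi * l * 1) *
      Real.exp (2 * Real.pi * n * t)) atTop (𝓝 0) := by
    have hneg : 2 * Real.pi * (n : ℝ) < 0 :=
      mul_neg_of_pos_of_neg (by positivity) (by exact_mod_cast hn)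
    simpa using (Real.tendsto_exp_atBot.comp (tendsto_id.const_mul_atTop_of_neg hneg)).const_mul
      (B * Real.exp (2 * Real.pi * l * 1))
  exact norm_le_zero_iff.1 (ge_of_tendsto h2 h1)

/-- The degrees of the variables add up to an integer, since `J_W` has determinant one. -/
theorem exists_int_eq_cHat (hJ : W.J ∈ W.SL) :
    ∃ c : ℤ, (c : ℚ) = W.cHat ∧ (-1 : ℂ) ^ d = (-1 : ℂ) ^ c := by
  have h := congrArg Units.val hJ.2
  have h1 : Complex.exp (2 * Real.pi * Complex.I * ((∑ j, W.q j : ℚ) : ℂ)) =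
      Complex.exp (2 * Real.pi * Complex.I * 0) := by
    rw [mul_zero, Complex.exp_zero, Rat.cast_sum, Finset.mul_sum, Complex.exp_sum]
    simpa [Potential.J] using h
  obtain ⟨m, hm⟩ := exists_int_of_exp_eq h1
  rw [zero_add] at hm
  have hm' : ∑ j, W.q j = (m : ℚ) := by exact_mod_cast hm
  refine ⟨d - 2 * m, by simp [Potential.cHat, hm'], ?_⟩
  rw [zpow_sub₀ (by norm_num), zpow_mul]
  simp

theorem Ell_cusp (hSL : G ≤ W.SL) (hJ : W.J ∈ G) {c : ℤ}
    (hd : (-1 : ℂ) ^ d = (-1 : ℂ) ^ c) :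
    ∃ a : ℕ → ℤ → ℂ, ∀ z τ : ℂ, 0 < τ.im →
      HasSum (fun p : ℕ × ℤ => a p.1 p.2 *
        Complex.exp (2 * Real.pi * Complex.I * τ * (p.1 : ℂ)) *
        Complex.exp (2 * Real.pi * Complex.I * z * ((p.2 : ℂ) + (c : ℂ) / 2))) (Ell W G z τ) := by
  -- Dividing by `exp (π i ĉ z)` turns the sign `(-1) ^ ĉ` under `z ↦ z + 1` into periodicity.
  set F : ℂ → ℂ → ℂ := fun z τ =>
    Complex.exp (-(Real.pi * Complex.I * c * z)) * Ell W G z τ with hFdef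
  have hF : DifferentiableOn ℂ (fun p : ℂ × ℂ => F p.1 p.2) {p | 0 < p.2.im} :=
    DifferentiableOn.mul (by fun_prop) (differentiableOn_Ell hSL)
  have hz (z τ : ℂ) (h : 0 < τ.im) : F (z + 1) τ = F z τ := by
    have h1 : Complex.exp (-(Real.pi * Complex.I * c * (z + 1))) * (-1 : ℂ) ^ c =
        Complex.exp (-(Real.pi * Complex.I * c * z)) := by
      rw [← Complex.exp_pi_mul_I, ← Complex.exp_int_mul, ← Complex.exp_add]
      ring_nf
    simp only [hFdef]
    rw [Ell_z_add_one hSL hJ z h, hd, ← mul_assoc, h1]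
  have hτ (z τ : ℂ) (h : 0 < τ.im) : F z (τ + 1) = F z τ := by
    simp only [hFdef]
    rw [Ell_tau_add_one hSL z h]
  obtain ⟨B, hB⟩ := eventually_norm_Ell_le hSL
  have hzero {n : ℤ} (hn : n < 0) (l : ℤ) : torusCoeff F 1 1 n l = 0 := by
    refine torusCoeff_eq_zero_of_bounded hF hz hτ (B := Real.exp (Real.pi * c) * B)
      (hB.mono fun t ht z τ hz hτ => ?_) hn l
    rw [norm_mul, Complex.norm_exp]
    have : (-(Real.pi * Complex.I * c * z) : ℂ).re = Real.pi * c := by simp [hz]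
    rw [this]
    gcongr
    exact ht z τ hz hτ
  refine ⟨fun n l => torusCoeff F 1 1 n l, fun z τ h => ?_⟩
  have hsum := hasSum_torusCoeff hF hz hτ 1 one_pos z τ h
  have hinj : Function.Injective fun p : ℕ × ℤ => ((p.1 : ℤ), p.2) := fun p p' h => by
    simpa [Prod.ext_iff] using h
  rw [← hinj.hasSum_iff] at hsum
  · have := hsum.mul_left (Complex.exp (Real.pi * Complex.I * c * z))
    rw [show Complex.exp (Real.pi * Complex.I * c * z) * F z τ = Ell W G z τ by
      rw [hFdef, ← mul_assoc, ← Complex.exp_add, add_neg_cancel, Complex.exp_zero, one_mul]] at this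
    refine (congrArg (HasSum · _) (funext fun p => ?_)).mpr this
    have he : Complex.exp (2 * Real.pi * Complex.I * z * ((p.2 : ℂ) + (c : ℂ) / 2)) =
        Complex.exp (Real.pi * Complex.I * c * z) *
          Complex.exp (2 * Real.pi * Complex.I * p.2 * z) := by
      rw [← Complex.exp_add]
      ring_nf
    simp only [Function.comp_apply, Int.cast_natCast]
    rw [he, mul_right_comm (2 * (Real.pi : ℂ) * Complex.I) τ]
    ring
  · rintro ⟨n, l⟩ hnl
    rw [hzero, zero_mul, zero_mul]
    by_contra! hn
    exact hnl ⟨(n.toNat, l), by simp [hn]⟩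

end BerglundHubsch

end

open BerglundHubsch

theorem mainTheorem3 {d : ℕ} (W : BerglundHubsch.Potential d)
    (G : Subgroup (Fin d → ℂˣ)) (hJ : W.J ∈ G) (hSL : G ≤ W.SL) :
    ({p : ℂ × ℂ | 0 < p.2.im} ⊆ closure (BerglundHubsch.regularLocus W G) ∧
      ∀ p ∈ BerglundHubsch.regularLocus W G,
        BerglundHubsch.Ell W G p.1 p.2 = BerglundHubsch.ellQuotient W G p) ∧
    ∃ c : ℤ, (c : ℚ) = W.cHat ∧
      BerglundHubsch.IsWeakJacobiForm 0 c (BerglundHubsch.Ell W G) ∧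
      ∀ z τ : ℂ, 0 < τ.im →
        BerglundHubsch.Ell W G z (τ + 1) = BerglundHubsch.Ell W G z τ ∧
        BerglundHubsch.Ell W G (z + 1) τ = (-1 : ℂ) ^ c * BerglundHubsch.Ell W G z τ ∧
        BerglundHubsch.Ell W G (z + τ) τ =
          (-1 : ℂ) ^ c * Complex.exp (-(Complex.I * Real.pi * c * (τ + 2 * z))) *
            BerglundHubsch.Ell W G z τ ∧
        BerglundHubsch.Ell W G (z / τ) (-1 / τ) =
          Complex.exp (Complex.I * Real.pi * c * z ^ 2 / τ) * BerglundHubsch.Ell W G z τ := by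
  refine ⟨⟨subset_closure_regularLocus hSL, fun p hp => Ell_eq_ellQuotient hSL hp⟩, ?_⟩
  obtain ⟨c, hc, hd⟩ := exists_int_eq_cHat (hSL hJ)
  have hc' : (W.cHat : ℂ) = c := by
    rw [← hc]
    simp
  have hT (z τ : ℂ) (hτ : 0 < τ.im) := Ell_tau_add_one hSL z hτ
  have h1 (z τ : ℂ) (hτ : 0 < τ.im) := Ell_z_add_one hSL hJ z hτ
  have h2 (z τ : ℂ) (hτ : 0 < τ.im) := Ell_z_add_tau hSL hJ z hτ
  have hS (z τ : ℂ) (hτ : 0 < τ.im) := Ell_inversion hSL z hτ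
  simp only [hd, hc'] at h1 h2 hS
  refine ⟨c, hc, ⟨differentiableOn_Ell hSL, fun g z τ hτ => ?_, fun l m z τ hτ => ?_,
    Ell_cusp hSL hJ hd⟩, fun z τ hτ => ⟨hT z τ hτ, h1 z τ hτ, h2 z τ hτ, hS z τ hτ⟩⟩
  · rw [zpow_zero, one_mul]
    refine modular_of_generators (φ := fun p => Ell W G p.1 p.2)
      (K := 2 * Real.pi * Complex.I * ((c : ℂ) / 2)) (fun p hp => hT p.1 p.2 hp)
      (fun p hp => ?_) g (p := (z, τ)) hτ
    rw [hS p.1 p.2 hp]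
    ring_nf
  · have h0 : (-1 : ℂ) ^ c ≠ 0 := zpow_ne_zero _ (by norm_num)
    rw [elliptic_of_generators (φ := fun z => Ell W G z τ) (K := Complex.I * Real.pi * c) h0
      (fun z => h1 z τ hτ) (fun z => h2 z τ hτ) l m z, ← zpow_mul]
    congr 3
    ring
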